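/- Let $P_-$ be the square with vertices $v_0=(2,2)$, $v_1=(2,0)$, $v_2=(0,0)$, $v_3=(0,2)$ and $P_+$ the kite with vertices $w_0=(5,2)$, $w_1=(4,2)$, $w_2=(3,0)$, $w_3=(5,1)$; let $V_\pm$ be their vertex sets and $\mathrm{int}(P_\pm)$ their interiors, and let $xy$ denote the open segment between $x$ and $y$. The symplectic billiard map is $\phi(x,y)=(y,z)$, defined on the set $\mathcal P_{\max}$ of all $(x,y)\in (P_-\times P_+)\sqcup(P_+\times P_-)$ with $x\in P_\pm$, $y\in P_\mp\setminus V_\mp$, for which there is a unique $z\in P_\pm$, $z\neq x$, such that $z-x$ is parallel to the edge of $P_\mp$ containing $y$ and $xz\subset\mathrm{int}(P_\pm)$. Put $N_0=(P_-\times V_+)\sqcup(P_+\times V_-)$, $N_{i+1}=\phi^{-1}(N_i)$, $\sigma(x,y)=(y,x)$, $N=\bigcup_i N_i\cup\sigma(\bigcup_i N_i)$, and let $\mathcal P=\mathcal P_{\max}\setminus N$ be the phase space. Let $S$ be the dyadic odometer on $\{0,1\}^{\mathbb N}$, $S(1,\dots,1,0,a_k,a_{k+1},\dots)=(0,\dots,0,1,a_k,a_{k+1},\dots)$,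 $S(1,1,1,\dots)=(0,0,0,\dots)$, and let $\tau$ be the von Neumann–Kakutani transformation, i.e. $S$ acting on the binary expansions of the numbers $t\in(0,1)$. For $x$ in the open edge $w_0w_1$ and $(a,b)\in\{(v_0,v_1),(v_2,v_3)\}$, or $x$ in the open edge $w_3w_0$ and $(a,b)\in\{(v_0,v_3),(v_2,v_1)\}$, let $\Sigma_{x,a,b}=\mathcal P\cap(\{x\}\times ab)$, and identify $\{x\}\times ab$ with $(0,1)$ by $t\mapsto (x,(1-t)a+tb)$. Then: 1. $\phi$ maps $\mathcal P$ bijectively onto itself, and has no periodic point in $\mathcal P$: for all $p\in\mathcal P$ and $n\ge1$, $\phi^n(p)\ne p$. 2. For every $p\in\mathcal P$ there is $k\ge0$ such that $\phi^k(p)$ lies in one of the sets $\Sigma_{x,a,b}$. 3. Under the above identification, $\Sigma_{x,a,b}$ consists exactly of the $t\in(0,1)$ that are not dyadic rationals, and the first return map of $\phi$ to $\Sigma_{x,a,b}$ is $t\mapsto\tau(t)$. 4. For $\ell\ge0$ and $t\in(1-2^{-\ell},\,1-2^{-(\ell+1)})$ one has $\tau(t)=t-1+2^{-\ell}+2^{-(\ell+1)}$,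 and if $t$ is not a dyadic rational, the first return time to $\Sigma_{x,a,b}$ is $4(\ell+1)$. 5. $\tau$ has no periodic point among the non-dyadic $t\in(0,1)$, and $S$ has no periodic point in $\{0,1\}^{\mathbb N}$. -/

import Mathlib

namespace SymplecticBilliards

/-- The plane. Only its affine structure and its topology are used. -/
abbrev Plane : Type := ℝ × ℝ

section Polygons

variable {n : ℕ}

/-- The `i`-th open edge of a polygon, from the `i`-th vertex to the cyclically next one. -/
def openEdge (Q : Polygon Plane n) (i : Fin n) : Set Plane :=
  openSegment ℝ (Q i) (Q (finRotate n i))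

/-- The bounded part of the complement of the closed curve formed by the edges, that is, the set of
points whose connected component in that complement is bounded. -/
def polygonInterior (Q : Polygon Plane n) : Set Plane :=
  {x | x ∉ Q.boundary ℝ ∧ Bornology.IsBounded (connectedComponentIn (Q.boundary ℝ)ᶜ x)}

end Polygons

/-- A pair of polygons `(P₋, P₊)`, indexed by a sign: `false` is `-` and `true` is `+`. -/
structure PolygonPair where
  numVertices : Bool → ℕ
  table : (s : Bool) → Polygon Plane (numVertices s)

/-- A point `(x, y)` tagged by a sign: the tag `s` says that `x` is regarded as a point of the
table `s` and `y` as a point of the other table `!s`. The tag makes the union of `P₋ × P₊` and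
`P₊ × P₋` a disjoint one. -/
@[ext]
structure PhasePoint where
  sign : Bool
  x : Plane
  y : Plane

/-- The swap map `σ (x, y) = (y, x)`. -/
def swap (p : PhasePoint) : PhasePoint := ⟨!p.sign, p.y, p.x⟩

namespace PolygonPair

variable (T : PolygonPair)

/-- The disjoint union of `P₋ × P₊` and `P₊ × P₋`. -/
def product : Set PhasePoint :=
  {p | p.x ∈ (T.table p.sign).boundary ℝ ∧ p.y ∈ (T.table (!p.sign)).boundary ℝ}

/-- The second entry of the point is a vertex of its table. -/
def SecondIsVertex (p : PhasePoint) : Prop := ∃ i, p.y = T.table (!p.sign) i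

/-- For `p = (x, y)`, the point `z` lies on the table of `x`, is different from `x`, the vector
`z - x` is tangent to the other table at `y` (a multiple of the edge that contains `y`), and the
open segment from `x` to `z` lies in the interior of the table of `x`. -/
def IsReflection (p : PhasePoint) (z : Plane) : Prop :=
  z ∈ (T.table p.sign).boundary ℝ ∧
  (∃ i, p.y ∈ openEdge (T.table (!p.sign)) i ∧
    ∃ c : ℝ, c ≠ 0 ∧
      z = p.x + c • (T.table (!p.sign) (finRotate _ i) - T.table (!p.sign) i)) ∧
  openSegment ℝ p.x z ⊆ polygonInterior (T.table p.sign)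

/-- The maximal phase space: the points where the symplectic billiard map is defined. -/
def maximalPhaseSpace : Set PhasePoint :=
  {p | p ∈ T.product ∧ ¬ T.SecondIsVertex p ∧ ∃! z, T.IsReflection p z}

open Classical in
/-- The symplectic billiard map `(x, y) ↦ (y, z)` on the maximal phase space. (Outside of the
maximal phase space it is set to be the identity, which plays no role.) -/
noncomputable def billiardMap (p : PhasePoint) : PhasePoint :=
  if h : p ∈ T.maximalPhaseSpace then ⟨!p.sign, p.y, h.2.2.choose⟩ else p

/-- The sets `N₀ = (P₋ × V₊) ⊔ (P₊ × V₋)` and `Nᵢ₊₁ = φ⁻¹(Nᵢ)`, the preimage being taken in the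
maximal phase space. -/
def discontinuityLevel : ℕ → Set PhasePoint
  | 0 => {p | p ∈ T.product ∧ T.SecondIsVertex p}
  | i + 1 => {p | p ∈ T.maximalPhaseSpace ∧ T.billiardMap p ∈ discontinuityLevel i}

/-- The discontinuity set. -/
def discontinuitySet : Set PhasePoint :=
  (⋃ i, T.discontinuityLevel i) ∪ swap '' (⋃ i, T.discontinuityLevel i)

/-- The phase space of the symplectic billiard map. -/
def phaseSpace : Set PhasePoint := T.maximalPhaseSpace \ T.discontinuitySet

end PolygonPair

/-! ### The necktie -/

/-- The square with vertices `v₀ = (2,2)`, `v₁ = (2,0)`, `v₂ = (0,0)`, `v₃ = (0,2)`. -/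
def square : Polygon Plane 4 := ⟨![(2, 2), (2, 0), (0, 0), (0, 2)]⟩

/-- The kite with vertices `w₀ = (5,2)`, `w₁ = (4,2)`, `w₂ = (3,0)`, `w₃ = (5,1)`. -/
def kite : Polygon Plane 4 := ⟨![(5, 2), (4, 2), (3, 0), (5, 1)]⟩

/-- The necktie: `P₋` is the square and `P₊` is the kite. -/
def necktie : PolygonPair := ⟨fun _ => 4, fun s => if s then kite else square⟩

/-- `x` is a point of the open edge `w₀w₁` and `(a, b)` is `(v₀, v₁)` or `(v₂, v₃)`, or `x` is a
point of the open edge `w₃w₀` and `(a, b)` is `(v₀, v₃)` or `(v₂, v₁)`. -/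
def IsBase (x a b : Plane) : Prop :=
  (x ∈ openSegment ℝ (kite 0) (kite 1) ∧
    ((a = square 0 ∧ b = square 1) ∨ (a = square 2 ∧ b = square 3))) ∨
  (x ∈ openSegment ℝ (kite 3) (kite 0) ∧
    ((a = square 0 ∧ b = square 3) ∨ (a = square 2 ∧ b = square 1)))

/-- The identification of `(0, 1)` with `{x} × ab`, `x` being in the kite and `ab` being a side of
the square: `t` corresponds to `(x, (1 - t) a + t b)`. -/
noncomputable def slicePoint (x a b : Plane) (t : ℝ) : PhasePoint :=
  ⟨true, x, (1 - t) • a + t • b⟩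

/-- The part of the phase space of the necktie in `{x} × ab`. -/
def slice (x a b : Plane) : Set PhasePoint :=
  necktie.phaseSpace ∩ slicePoint x a b '' Set.Ioo 0 1

/-- The first return of `p` to the set `A` under iteration of `f` happens at time `n`, at the
point `q`. -/
def IsFirstReturn {α : Type*} (f : α → α) (A : Set α) (p : α) (n : ℕ) (q : α) : Prop :=
  0 < n ∧ f^[n] p = q ∧ q ∈ A ∧ ∀ m, 0 < m → m < n → f^[m] p ∉ A

/-! ### The dyadic odometer and the von Neumann–Kakutani transformation -/

/-- `t` is a dyadic rational. -/
def IsDyadic (t : ℝ) : Prop := ∃ (k : ℤ) (n : ℕ), t = k / 2 ^ n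

/-- The dyadic odometer `(1, …, 1, 0, a, b, …) ↦ (0, …, 0, 1, a, b, …)`: an entry is flipped if
and only if all the entries before it are `1`. -/
def odometer (a : ℕ → Fin 2) : ℕ → Fin 2 :=
  fun i => if ∀ j < i, a j = 1 then 1 - a i else a i

/-- The von Neumann–Kakutani transformation: the dyadic odometer acting on binary expansions of
numbers in `(0, 1)`. -/
noncomputable def vonNeumannKakutani (t : ℝ) : ℝ :=
  Real.ofDigits (odometer (Real.digits t 2))

end SymplecticBilliards

open SymplecticBilliards

/-! Up to a group of four symmetries, a pair of points on nonparallel open edges has one of six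
types, with a parameter `u` in (0,2) locating the kite point and `t` in (0,1) locating the square
point. In these parameters the billiard performs binary addition of one, with `u` counting the
carries.

From `topRight u t`, 1 < u < 2, the orbit enters `rightLower u t`, where a chord of slope 1/2 in the
square reads the first binary digit of `t`. A digit 1 is removed (t ↦ 2t - 1) and `u` is halved as a
record. A digit 0 becomes 1 (t ↦ t + 1/2) and the orbit passes to `lowerLeft`. There each doubling
of `u` comes with t ↦ t/2, which puts a digit 0 in front, until `u` exceeds 1 again and the orbit
returns to `topRight u t'`. With `l` carries this takes 4(l + 1) steps, and t' = τ(t)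
(`AddOne.isPath`, `AddOne.iterate_topRight`, `AddOne.vonNeumannKakutani_eq`).

A vertex can be met only from u = 1 or t = 1/2 (`IsState.step`). A non-dyadic `t` with `u` not a
power of two never leads there (`IsState.not_isSingular`); a dyadic `t` is carried to some 1 - 2⁻ʲ,
whose orbit ends in a corner of the square (`IsDyadic.hitsBreak`, `HitsBreak.isSingular`).
Bijectivity follows from reversibility under `swap`. Since every orbit visits a slice
(`visitsTop_of_mem_phaseSpace`), a periodic orbit would give a cycle of the odometer, and there is
none (`odometer_iterate_ne`). -/

namespace SymplecticBilliards

/-! ### The tables as intersections of half-planes -/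

/-- The tables are cut out by four affine inequalities `0 ≤ side s k`; `side s k` is
`slope s k` plus a constant. -/
def slope : Bool → Fin 4 → Plane → ℝ
  | false => fun k v => ![v.1, v.2, -v.1, -v.2] k
  | true => fun k v => ![-v.2, -v.1, 2 * v.1 - v.2, 2 * v.2 - v.1] k

/-- The affine function vanishing on a side of a table and nonnegative on the table. -/
def side (s : Bool) (k : Fin 4) (v : Plane) : ℝ :=
  slope s k v + (if s then ![2, 5, -6, 3] k else ![0, 0, 2, 2] k)

/-- The closed convex region bounded by a table. -/
def region (s : Bool) : Set Plane := {v | ∀ k, 0 ≤ side s k v}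

/-- The open convex region bounded by a table. -/
def inner (s : Bool) : Set Plane := {v | ∀ k, 0 < side s k v}

lemma side_add_smul (s : Bool) (k : Fin 4) (v d : Plane) (c : ℝ) :
    side s k (v + c • d) = side s k v + c * slope s k d := by
  cases s <;> fin_cases k <;> simp [side, slope] <;> ring

lemma side_convexComb (s : Bool) (k : Fin 4) (v w : Plane) {a b : ℝ} (h : a + b = 1) :
    side s k (a • v + b • w) = a * side s k v + b * side s k w := by
  obtain rfl : b = 1 - a := by linarith
  cases s <;> fin_cases k <;> simp [side, slope] <;> ring

lemma continuous_side (s : Bool) (k : Fin 4) : Continuous (side s k) := by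
  unfold side
  refine Continuous.add ?_ continuous_const
  cases s <;> fin_cases k <;> simp [slope] <;> fun_prop

lemma mem_region_true {v : Plane} : v ∈ region true ↔
    v.2 ≤ 2 ∧ v.1 ≤ 5 ∧ v.2 ≤ 2 * (v.1 - 3) ∧ v.1 - 3 ≤ 2 * v.2 := by
  simp only [region, side, slope, Set.mem_ofPred_eq, Fin.forall_fin_succ]
  simp
  grind

lemma mem_inner_true {v : Plane} : v ∈ inner true ↔
    v.2 < 2 ∧ v.1 < 5 ∧ v.2 < 2 * (v.1 - 3) ∧ v.1 - 3 < 2 * v.2 := by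
  simp only [inner, side, slope, Set.mem_ofPred_eq, Fin.forall_fin_succ]
  simp
  grind

lemma mem_region_false {v : Plane} : v ∈ region false ↔
    0 ≤ v.1 ∧ 0 ≤ v.2 ∧ v.1 ≤ 2 ∧ v.2 ≤ 2 := by
  simp only [region, side, slope, Set.mem_ofPred_eq, Fin.forall_fin_succ]
  simp

lemma mem_inner_false {v : Plane} : v ∈ inner false ↔
    0 < v.1 ∧ 0 < v.2 ∧ v.1 < 2 ∧ v.2 < 2 := by
  simp only [inner, side, slope, Set.mem_ofPred_eq, Fin.forall_fin_succ]
  simp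

lemma mem_plane_segment {a b v : Plane} : v ∈ segment ℝ a b ↔
    ∃ r : ℝ, 0 ≤ r ∧ r ≤ 1 ∧ v.1 = a.1 + r * (b.1 - a.1) ∧ v.2 = a.2 + r * (b.2 - a.2) := by
  rw [segment_eq_image']
  constructor
  · rintro ⟨r, hr, rfl⟩
    exact ⟨r, hr.1, hr.2, by simp, by simp⟩
  · rintro ⟨r, h0, h1, h⟩
    exact ⟨r, ⟨h0, h1⟩, by ext <;> simp [h]⟩

lemma mem_plane_openSegment {a b v : Plane} : v ∈ openSegment ℝ a b ↔
    ∃ r : ℝ, 0 < r ∧ r < 1 ∧ v.1 = a.1 + r * (b.1 - a.1) ∧ v.2 = a.2 + r * (b.2 - a.2) := by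
  rw [openSegment_eq_image']
  constructor
  · rintro ⟨r, hr, rfl⟩
    exact ⟨r, hr.1, hr.2, by simp, by simp⟩
  · rintro ⟨r, h0, h1, h⟩
    exact ⟨r, ⟨h0, h1⟩, by ext <;> simp [h]⟩

lemma mem_boundary {Q : Polygon Plane 4} {v : Plane} : v ∈ Q.boundary ℝ ↔
    v ∈ segment ℝ (Q 0) (Q 1) ∨ v ∈ segment ℝ (Q 1) (Q 2) ∨ v ∈ segment ℝ (Q 2) (Q 3) ∨
      v ∈ segment ℝ (Q 3) (Q 0) := by
  simp [Polygon.boundary, Polygon.edgeSet, affineSegment_eq_segment, Fin.exists_fin_succ]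

lemma square_boundary : square.boundary ℝ = region false \ inner false := by
  ext v
  rw [mem_boundary, Set.mem_sdiff, mem_region_false, mem_inner_false]
  simp only [mem_plane_segment, square]
  simp
  constructor
  · rintro (⟨r, h⟩ | ⟨r, h⟩ | ⟨r, h⟩ | ⟨r, h⟩) <;> grind
  · rintro ⟨⟨h1, h2, h3, h4⟩, h⟩
    by_cases e1 : v.1 = 0
    · exact Or.inr (Or.inr (Or.inl ⟨v.2 / 2, by grind⟩))
    by_cases e2 : v.2 = 0
    · exact Or.inr (Or.inl ⟨1 - v.1 / 2, by grind⟩)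
    by_cases e3 : v.1 = 2
    · exact Or.inl ⟨1 - v.2 / 2, by grind⟩
    by_cases e4 : v.2 = 2
    · exact Or.inr (Or.inr (Or.inr ⟨v.1 / 2, by grind⟩))
    grind

lemma kite_boundary : kite.boundary ℝ = region true \ inner true := by
  ext v
  rw [mem_boundary, Set.mem_sdiff, mem_region_true, mem_inner_true]
  simp only [mem_plane_segment, kite]
  simp
  constructor
  · rintro (⟨r, h⟩ | ⟨r, h⟩ | ⟨r, h⟩ | ⟨r, h⟩) <;> grind
  · rintro ⟨⟨h1, h2, h3, h4⟩, h⟩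
    by_cases e1 : v.2 = 2
    · exact Or.inl ⟨5 - v.1, by grind⟩
    by_cases e2 : v.1 = 5
    · exact Or.inr (Or.inr (Or.inr ⟨v.2 - 1, by grind⟩))
    by_cases e3 : v.2 = 2 * (v.1 - 3)
    · exact Or.inr (Or.inl ⟨4 - v.1, by grind⟩)
    by_cases e4 : v.1 - 3 = 2 * v.2
    · exact Or.inr (Or.inr (Or.inl (by grind)))
    grind

lemma table_boundary (s : Bool) : (necktie.table s).boundary ℝ = region s \ inner s := by
  cases s
  · exact square_boundary
  · exact kite_boundary

/-! ### The open convex regions lie in the polygon interiors -/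

lemma isOpen_inner (s : Bool) : IsOpen (inner s) := by
  simp only [inner, Set.ofPred_forall]
  exact isOpen_iInter_of_finite fun k => isOpen_lt continuous_const (continuous_side s k)

lemma isClosed_region (s : Bool) : IsClosed (region s) := by
  simp only [region, Set.ofPred_forall]
  exact isClosed_iInter fun k => isClosed_le continuous_const (continuous_side s k)

lemma inner_subset_region (s : Bool) : inner s ⊆ region s := fun _ h k => (h k).le

lemma isBounded_region (s : Bool) : Bornology.IsBounded (region s) := by
  refine (Metric.isBounded_Icc ((0, 0) : Plane) (5, 2)).subset fun v hv => ?_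
  rw [Set.mem_Icc, Prod.le_def, Prod.le_def]
  cases s
  · rw [mem_region_false] at hv
    simp; grind
  · rw [mem_region_true] at hv
    simp; grind

/-- The complement of the boundary is covered by two disjoint open sets, `inner s` and the
complement of `region s`. The component of a point of `inner s` therefore stays in `inner s`, which
is bounded. The reverse inclusion is not needed. -/
lemma inner_subset_polygonInterior (s : Bool) :
    inner s ⊆ polygonInterior (necktie.table s) := by
  intro v hv
  have hB := table_boundary s
  have hvB : v ∉ (necktie.table s).boundary ℝ := by rw [hB]; exact fun h => h.2 hv
  refine ⟨hvB, ((isBounded_region s).subset (inner_subset_region s)).subset ?_⟩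
  refine isPreconnected_connectedComponentIn.subset_left_of_subset_union (isOpen_inner s)
    (isClosed_region s).isOpen_compl
    (Set.disjoint_compl_right_iff_subset.mpr (inner_subset_region s)) (fun w hw => ?_)
    ⟨v, mem_connectedComponentIn hvB, hv⟩
  have hw' := connectedComponentIn_subset _ _ hw
  rw [hB] at hw'
  by_contra h
  exact hw' ⟨by_contra fun h' => h (Or.inr h'), fun h' => h (Or.inl h')⟩

/-! ### The reflection rule in coordinates, and its uniqueness -/

/-- The direction condition of the symplectic billiard rule, in coordinates. -/
def Parallel (p : PhasePoint) (z : Plane) : Prop :=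
  if p.sign then
    ((p.y.1 = 0 ∨ p.y.1 = 2) ∧ 0 < p.y.2 ∧ p.y.2 < 2 ∧ z.1 = p.x.1) ∨
    ((p.y.2 = 0 ∨ p.y.2 = 2) ∧ 0 < p.y.1 ∧ p.y.1 < 2 ∧ z.2 = p.x.2)
  else
    (p.y.2 = 2 ∧ 4 < p.y.1 ∧ p.y.1 < 5 ∧ z.2 = p.x.2) ∨
    (p.y.1 = 5 ∧ 1 < p.y.2 ∧ p.y.2 < 2 ∧ z.1 = p.x.1) ∨
    (p.y.2 = 2 * (p.y.1 - 3) ∧ 3 < p.y.1 ∧ p.y.1 < 4 ∧ z.2 - p.x.2 = 2 * (z.1 - p.x.1)) ∨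
    (p.y.1 - 3 = 2 * p.y.2 ∧ 3 < p.y.1 ∧ p.y.1 < 5 ∧ z.1 - p.x.1 = 2 * (z.2 - p.x.2))

/-- Because `z ≠ p.x`, the condition `c ≠ 0` is automatic and can be dropped from the coordinate
form. -/
lemma exists_parallel_iff {p : PhasePoint} {z : Plane} (hz : z ≠ p.x) :
    (∃ i, p.y ∈ openEdge (necktie.table (!p.sign)) i ∧ ∃ c : ℝ, c ≠ 0 ∧
      z = p.x + c • (necktie.table (!p.sign) (finRotate _ i) - necktie.table (!p.sign) i)) ↔
    Parallel p z := by
  obtain ⟨s, x, y⟩ := p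
  obtain ⟨x1, x2⟩ := x
  obtain ⟨y1, y2⟩ := y
  obtain ⟨z1, z2⟩ := z
  have hz' : z1 = x1 → z2 ≠ x2 := fun h h' => hz (by simp [h, h'])
  cases s
  · change (∃ i : Fin 4, _ ∈ openEdge kite i ∧ ∃ c : ℝ, c ≠ 0 ∧
      _ = _ + c • (kite (finRotate 4 i) - kite i)) ↔ _
    simp only [Fin.exists_fin_succ, openEdge, mem_plane_openSegment, Parallel, kite]
    simp
    constructor
    · rintro (⟨⟨r, h⟩, c, hc⟩ | ⟨⟨r, h⟩, c, hc⟩ | ⟨h, c, hc⟩ | ⟨⟨r, h⟩, c, hc⟩) <;> grind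
    · rintro (h | h | h | h)
      · exact Or.inl ⟨⟨5 - y1, by grind⟩, x1 - z1, by grind⟩
      · exact Or.inr (Or.inr (Or.inr ⟨⟨y2 - 1, by grind⟩, z2 - x2, by grind⟩))
      · exact Or.inr (Or.inl ⟨⟨4 - y1, by grind⟩, x1 - z1, by grind⟩)
      · exact Or.inr (Or.inr (Or.inl ⟨by grind, z2 - x2, by grind⟩))
  · change (∃ i : Fin 4, _ ∈ openEdge square i ∧ ∃ c : ℝ, c ≠ 0 ∧
      _ = _ + c • (square (finRotate 4 i) - square i)) ↔ _
    simp only [Fin.exists_fin_succ, openEdge, mem_plane_openSegment, Parallel, square]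
    simp
    constructor
    · rintro (⟨⟨r, h⟩, c, hc⟩ | ⟨⟨r, h⟩, c, hc⟩ | ⟨⟨r, h⟩, c, hc⟩ | ⟨⟨r, h⟩, c, hc⟩) <;> grind
    · rintro (⟨h | h, h'⟩ | ⟨h | h, h'⟩)
      · exact Or.inr (Or.inr (Or.inl ⟨⟨y2 / 2, by grind⟩, (z2 - x2) / 2, by grind⟩))
      · exact Or.inl ⟨⟨1 - y2 / 2, by grind⟩, (x2 - z2) / 2, by grind⟩
      · exact Or.inr (Or.inl ⟨⟨1 - y1 / 2, by grind⟩, (x1 - z1) / 2, by grind⟩)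
      · exact Or.inr (Or.inr (Or.inr ⟨⟨y1 / 2, by grind⟩, (z1 - x1) / 2, by grind⟩))

/-- The symplectic billiard rule in coordinates: `z` is the reflection of `p.x`. -/
def Reflects (p : PhasePoint) (z : Plane) : Prop :=
  z ∈ region p.sign \ inner p.sign ∧ Parallel p z ∧
    (1 / 2 : ℝ) • p.x + (1 / 2 : ℝ) • z ∈ inner p.sign

lemma exists_direction (p : PhasePoint) :
    ∃ d : Plane, ∀ z, Parallel p z → ∃ c : ℝ, z = p.x + c • d := by
  obtain ⟨s, x, y⟩ := p
  by_cases h : ∃ z, Parallel ⟨s, x, y⟩ z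
  swap
  · exact ⟨0, fun z hz => absurd ⟨z, hz⟩ h⟩
  obtain ⟨w, hw⟩ := h
  cases s <;> simp only [Parallel, if_true, if_false, Bool.false_eq_true] at hw ⊢
  · rcases hw with h | h | h | h
    · exact ⟨(1, 0), fun z hz => ⟨z.1 - x.1, by ext <;> simp; grind⟩⟩
    · exact ⟨(0, 1), fun z hz => ⟨z.2 - x.2, by ext <;> simp; grind⟩⟩
    · exact ⟨(1, 2), fun z hz => ⟨z.1 - x.1, by ext <;> simp; grind⟩⟩
    · exact ⟨(2, 1), fun z hz => ⟨z.2 - x.2, by ext <;> simp; grind⟩⟩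
  · rcases hw with h | h
    · exact ⟨(0, 1), fun z hz => ⟨z.2 - x.2, by ext <;> simp; grind⟩⟩
    · exact ⟨(1, 0), fun z hz => ⟨z.1 - x.1, by ext <;> simp; grind⟩⟩

lemma exists_side_eq_zero {s : Bool} {v : Plane} (h : v ∈ region s \ inner s) :
    ∃ k, side s k v = 0 := by
  by_contra! hne
  exact h.2 fun k => lt_of_le_of_ne (h.1 k) (hne k).symm

/-- Two different solutions would give three boundary points `p.x`, `z`, `w` on one line. The affine
function of a side through the middle one vanishes there and is nonnegative at the outer two, so it
vanishes on the whole line; but it is positive at the midpoints of the chords. -/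
lemma Reflects.unique {p : PhasePoint} {z w : Plane}
    (hx : p.x ∈ region p.sign \ inner p.sign) (hz : Reflects p z) (hw : Reflects p w) :
    z = w := by
  obtain ⟨d, hd⟩ := exists_direction p
  obtain ⟨a, rfl⟩ := hd z hz.2.1
  obtain ⟨b, rfl⟩ := hd w hw.2.1
  have key : ∀ a b : ℝ, Reflects p (p.x + a • d) → Reflects p (p.x + b • d) → ¬ a < b := by
    intro a b ha hb hab
    obtain ⟨k, hk⟩ := exists_side_eq_zero hx
    obtain ⟨l, hl⟩ := exists_side_eq_zero ha.1
    obtain ⟨m, hm⟩ := exists_side_eq_zero hb.1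
    have h1 := ha.2.2
    have h2 := hb.2.2
    have hx' := hx.1
    have ha' := ha.1.1
    have hb' := hb.1.1
    simp only [inner, region, Set.mem_ofPred_eq, side_add_smul,
      side_convexComb _ _ _ _ (add_halves (1 : ℝ))] at *
    have hka := h1 k
    have hkb := h2 k
    rw [hk] at hka hkb
    have hla := h1 l
    have hmb := h2 m
    have hlb := hb' l
    have hlx := hx' l
    have hma := ha' m
    have hmx := hx' m
    rcases lt_or_ge 0 a with h | h
    · nlinarith
    · rcases lt_or_ge 0 b with h' | h'
      · nlinarith
      · nlinarith
  rcases lt_trichotomy a b with h | rfl | h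
  · exact absurd h (key a b hz hw)
  · rfl
  · exact absurd h (key b a hw hz)

lemma midpoint_mem_openSegment (v w : Plane) :
    (1 / 2 : ℝ) • v + (1 / 2 : ℝ) • w ∈ openSegment ℝ v w :=
  ⟨1 / 2, 1 / 2, by norm_num, by norm_num, by norm_num, rfl⟩

/-- By convexity the midpoint decides for the whole chord: a side function that is nonnegative at
both ends and positive at the midpoint is positive at one end, hence on the open segment. -/
lemma isReflection_iff {p : PhasePoint} {z : Plane}
    (hx : p.x ∈ region p.sign \ inner p.sign) :
    necktie.IsReflection p z ↔ Reflects p z := by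
  unfold PolygonPair.IsReflection Reflects
  rw [table_boundary]
  constructor
  · rintro ⟨hz, hd, hs⟩
    have hm := hs (midpoint_mem_openSegment p.x z)
    have hin : (1 / 2 : ℝ) • p.x + (1 / 2 : ℝ) • z ∈ inner p.sign := by
      have h := hm.1
      rw [table_boundary] at h
      refine by_contra fun h' => h ⟨fun k => ?_, h'⟩
      rw [side_convexComb _ _ _ _ (add_halves (1 : ℝ))]
      have := hx.1 k
      have := hz.1 k
      linarith
    refine ⟨hz, (exists_parallel_iff ?_).1 hd, hin⟩
    rintro rfl
    rw [← add_smul, add_halves, one_smul] at hin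
    exact hz.2 hin
  · rintro ⟨hz, hd, hin⟩
    refine ⟨hz, (exists_parallel_iff ?_).2 hd, ?_⟩
    · rintro rfl
      rw [← add_smul, add_halves, one_smul] at hin
      exact hz.2 hin
    · rintro _ ⟨a, b, ha, hb, hab, rfl⟩
      refine inner_subset_polygonInterior _ fun k => ?_
      have h := hin k
      have h1 := hx.1 k
      have h2 := hz.1 k
      rw [side_convexComb _ _ _ _ (add_halves (1 : ℝ))] at h
      rw [side_convexComb _ _ _ _ hab]
      rcases h1.lt_or_eq with h1 | h1
      · nlinarith [mul_pos ha h1, mul_nonneg hb.le h2]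
      · have : 0 < side p.sign k z := by linarith
        nlinarith [mul_pos hb this]

/-! ### The billiard map in coordinates -/

lemma mem_product_iff {p : PhasePoint} : p ∈ necktie.product ↔
    p.x ∈ region p.sign \ inner p.sign ∧ p.y ∈ region (!p.sign) \ inner (!p.sign) := by
  simp [PolygonPair.product, table_boundary]

lemma secondIsVertex_iff {p : PhasePoint} : necktie.SecondIsVertex p ↔
    if p.sign then p.y = (2, 2) ∨ p.y = (2, 0) ∨ p.y = (0, 0) ∨ p.y = (0, 2)
    else p.y = (5, 2) ∨ p.y = (4, 2) ∨ p.y = (3, 0) ∨ p.y = (5, 1) := by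
  obtain ⟨s, x, y⟩ := p
  cases s
  · change (∃ i : Fin 4, y = kite i) ↔ _
    simp [Fin.exists_fin_succ, kite]
  · change (∃ i : Fin 4, y = square i) ↔ _
    simp [Fin.exists_fin_succ, square]

lemma Parallel.not_secondIsVertex {p : PhasePoint} {z : Plane} (h : Parallel p z) :
    ¬ necktie.SecondIsVertex p := by
  rw [secondIsVertex_iff]
  obtain ⟨s, ⟨x1, x2⟩, ⟨y1, y2⟩⟩ := p
  cases s <;> simp [Parallel] at h ⊢ <;> grind

lemma mem_maximalPhaseSpace_iff {p : PhasePoint} : p ∈ necktie.maximalPhaseSpace ↔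
    p ∈ necktie.product ∧ ∃ z, Reflects p z := by
  constructor
  · rintro ⟨hp, -, z, hz, -⟩
    exact ⟨hp, z, (isReflection_iff (mem_product_iff.1 hp).1).1 hz⟩
  · rintro ⟨hp, z, hz⟩
    have hx := (mem_product_iff.1 hp).1
    exact ⟨hp, hz.2.1.not_secondIsVertex, z, (isReflection_iff hx).2 hz,
      fun w hw => ((isReflection_iff hx).1 hw).unique hx hz⟩

lemma billiardMap_eq {p : PhasePoint} {z : Plane} (hp : p ∈ necktie.product)
    (hz : Reflects p z) : necktie.billiardMap p = ⟨!p.sign, p.y, z⟩ := by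
  have h : p ∈ necktie.maximalPhaseSpace := mem_maximalPhaseSpace_iff.2 ⟨hp, z, hz⟩
  have hx := (mem_product_iff.1 hp).1
  rw [PolygonPair.billiardMap, dif_pos h]
  congr 1
  exact ((isReflection_iff hx).1 h.2.2.choose_spec.1).unique hx hz

lemma swap_swap (p : PhasePoint) : swap (swap p) = p := by simp [swap]

/-- The admissible direction depends only on `p.y`, and the midpoint condition is symmetric in the
ends of the chord. This is the source of reversibility. -/
lemma Reflects.symm {p : PhasePoint} {z : Plane}
    (hx : p.x ∈ region p.sign \ inner p.sign) (h : Reflects p z) :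
    Reflects ⟨p.sign, z, p.y⟩ p.x := by
  refine ⟨hx, ?_, by simpa only [add_comm] using h.2.2⟩
  have := h.2.1
  obtain ⟨s, x, y⟩ := p
  cases s <;> simp only [Parallel, if_true, if_false, Bool.false_eq_true] at this ⊢ <;> grind

/-- The billiard map is reversible. -/
lemma billiardMap_swap_billiardMap {p : PhasePoint} (hp : p ∈ necktie.maximalPhaseSpace) :
    swap (necktie.billiardMap p) ∈ necktie.maximalPhaseSpace ∧
      necktie.billiardMap (swap (necktie.billiardMap p)) = swap p := by
  obtain ⟨hp, z, hz⟩ := mem_maximalPhaseSpace_iff.1 hp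
  rw [billiardMap_eq hp hz]
  have hp' := mem_product_iff.1 hp
  have h1 : (⟨p.sign, z, p.y⟩ : PhasePoint) ∈ necktie.product :=
    mem_product_iff.2 ⟨hz.1, hp'.2⟩
  simp only [swap, Bool.not_not]
  exact ⟨mem_maximalPhaseSpace_iff.2 ⟨h1, _, hz.symm hp'.1⟩, billiardMap_eq h1 (hz.symm hp'.1)⟩

/-! ### Symmetries

The reflection of the square in its center preserves all the directions of its edges, and the
reflection in the diagonal of the square together with the one in the axis of the kite preserves
the necktie. They generate a group of four symmetries of the billiard map. -/

/-- The action of the symmetries on the tables. -/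
def tableSym (g : Bool × Bool) (s : Bool) (v : Plane) : Plane :=
  if s then (if g.2 then (v.2 + 3, v.1 - 3) else v)
  else
    let w := if g.2 then (v.2, v.1) else v
    if g.1 then (2 - w.1, 2 - w.2) else w

/-- The action of the symmetries on the phase points. -/
def sym (g : Bool × Bool) (p : PhasePoint) : PhasePoint :=
  ⟨p.sign, tableSym g p.sign p.x, tableSym g (!p.sign) p.y⟩

@[simp] lemma sym_sign (g : Bool × Bool) (p : PhasePoint) : (sym g p).sign = p.sign := rfl

lemma tableSym_tableSym (g h : Bool × Bool) (s : Bool) (v : Plane) :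
    tableSym g s (tableSym h s v) = tableSym (xor g.1 h.1, xor g.2 h.2) s v := by
  obtain ⟨_ | _, _ | _⟩ := g <;> obtain ⟨_ | _, _ | _⟩ := h <;> cases s <;> simp [tableSym]

lemma sym_sym (g h : Bool × Bool) (p : PhasePoint) :
    sym g (sym h p) = sym (xor g.1 h.1, xor g.2 h.2) p := by
  simp only [sym, tableSym_tableSym]

@[simp] lemma tableSym_one (s : Bool) (v : Plane) : tableSym (false, false) s v = v := by
  cases s <;> simp [tableSym]

@[simp] lemma sym_one (p : PhasePoint) : sym (false, false) p = p := by
  simp only [sym, tableSym_one]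

@[simp] lemma sym_sym_self (g : Bool × Bool) (p : PhasePoint) : sym g (sym g p) = p := by
  simp [sym_sym]

lemma swap_sym (g : Bool × Bool) (p : PhasePoint) : swap (sym g p) = sym g (swap p) := by
  simp [swap, sym]

lemma tableSym_mem_region {g : Bool × Bool} {s : Bool} {v : Plane} :
    tableSym g s v ∈ region s ↔ v ∈ region s := by
  obtain ⟨_ | _, _ | _⟩ := g <;> cases s <;>
    simp only [mem_region_true, mem_region_false, tableSym] <;> grind

lemma tableSym_mem_inner {g : Bool × Bool} {s : Bool} {v : Plane} :
    tableSym g s v ∈ inner s ↔ v ∈ inner s := by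
  obtain ⟨_ | _, _ | _⟩ := g <;> cases s <;>
    simp only [mem_inner_true, mem_inner_false, tableSym] <;> grind

lemma tableSym_midpoint (g : Bool × Bool) (s : Bool) (v w : Plane) :
    (1 / 2 : ℝ) • tableSym g s v + (1 / 2 : ℝ) • tableSym g s w =
      tableSym g s ((1 / 2 : ℝ) • v + (1 / 2 : ℝ) • w) := by
  obtain ⟨_ | _, _ | _⟩ := g <;> cases s <;> ext <;> simp [tableSym] <;> ring

lemma Parallel.sym {p : PhasePoint} {z : Plane} (g : Bool × Bool) (h : Parallel p z) :
    Parallel (sym g p) (tableSym g p.sign z) := by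
  obtain ⟨s, ⟨x1, x2⟩, ⟨y1, y2⟩⟩ := p
  obtain ⟨z1, z2⟩ := z
  obtain ⟨_ | _, _ | _⟩ := g <;> cases s <;>
    simp [Parallel, SymplecticBilliards.sym, tableSym] at h ⊢ <;> grind (splits := 20)

lemma Reflects.sym {p : PhasePoint} {z : Plane} (g : Bool × Bool) (h : Reflects p z) :
    Reflects (sym g p) (tableSym g p.sign z) := by
  refine ⟨⟨tableSym_mem_region.2 h.1.1, fun h' => h.1.2 (tableSym_mem_inner.1 h')⟩,
    h.2.1.sym g, ?_⟩
  have := tableSym_mem_inner (g := g).2 h.2.2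
  rwa [← tableSym_midpoint] at this

lemma sym_mem_product {g : Bool × Bool} {p : PhasePoint} :
    sym g p ∈ necktie.product ↔ p ∈ necktie.product := by
  simp only [mem_product_iff, Set.mem_sdiff, sym, tableSym_mem_inner, tableSym_mem_region]

lemma sym_secondIsVertex {g : Bool × Bool} {p : PhasePoint} :
    necktie.SecondIsVertex (sym g p) ↔ necktie.SecondIsVertex p := by
  have key : ∀ p, necktie.SecondIsVertex p → necktie.SecondIsVertex (sym g p) := by
    rintro ⟨s, ⟨x1, x2⟩, ⟨y1, y2⟩⟩ h
    rw [secondIsVertex_iff] at h ⊢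
    obtain ⟨_ | _, _ | _⟩ := g <;> cases s <;> simp [sym, tableSym] at h ⊢ <;> grind
  exact ⟨fun h => by simpa using key _ h, key p⟩

lemma sym_mem_maximalPhaseSpace {g : Bool × Bool} {p : PhasePoint} :
    sym g p ∈ necktie.maximalPhaseSpace ↔ p ∈ necktie.maximalPhaseSpace := by
  have key : ∀ p, p ∈ necktie.maximalPhaseSpace → sym g p ∈ necktie.maximalPhaseSpace := by
    intro p h
    rw [mem_maximalPhaseSpace_iff] at h ⊢
    exact ⟨sym_mem_product.2 h.1, h.2.imp' _ fun z hz => hz.sym g⟩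
  exact ⟨fun h => by simpa using key _ h, key p⟩

lemma billiardMap_sym (g : Bool × Bool) (p : PhasePoint) :
    necktie.billiardMap (sym g p) = sym g (necktie.billiardMap p) := by
  by_cases h : p ∈ necktie.maximalPhaseSpace
  · obtain ⟨hp, z, hz⟩ := mem_maximalPhaseSpace_iff.1 h
    rw [billiardMap_eq hp hz, billiardMap_eq (sym_mem_product.2 hp) (hz.sym g)]
    simp [sym]
  · rw [PolygonPair.billiardMap, PolygonPair.billiardMap, dif_neg h,
      dif_neg (mt sym_mem_maximalPhaseSpace.1 h)]

lemma iterate_billiardMap_sym (g : Bool × Bool) (n : ℕ) (p : PhasePoint) :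
    necktie.billiardMap^[n] (sym g p) = sym g (necktie.billiardMap^[n] p) :=
  (show Function.Semiconj (sym g) necktie.billiardMap necktie.billiardMap from
    fun p => (billiardMap_sym g p).symm).iterate_right n p |>.symm

lemma sym_mem_discontinuityLevel {g : Bool × Bool} {i : ℕ} {p : PhasePoint} :
    sym g p ∈ necktie.discontinuityLevel i ↔ p ∈ necktie.discontinuityLevel i := by
  induction i generalizing p with
  | zero => exact and_congr sym_mem_product sym_secondIsVertex
  | succ i ih =>
    refine and_congr sym_mem_maximalPhaseSpace ?_
    rw [billiardMap_sym]
    exact ih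

/-! ### The phase space -/

/-- The orbit of the point ends in a vertex. -/
def IsSingular (p : PhasePoint) : Prop := ∃ i, p ∈ necktie.discontinuityLevel i

lemma mem_phaseSpace_iff {p : PhasePoint} : p ∈ necktie.phaseSpace ↔
    p ∈ necktie.maximalPhaseSpace ∧ ¬ IsSingular p ∧ ¬ IsSingular (swap p) := by
  rw [PolygonPair.phaseSpace, Set.mem_sdiff, PolygonPair.discontinuitySet, Set.mem_union, not_or]
  refine and_congr_right fun _ => and_congr (by simp [IsSingular]) (not_congr ?_)
  rw [Set.mem_image]
  constructor
  · rintro ⟨q, hq, rfl⟩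
    rw [swap_swap]
    exact Set.mem_iUnion.1 hq
  · exact fun h => ⟨swap p, Set.mem_iUnion.2 h, swap_swap p⟩

lemma sym_isSingular {g : Bool × Bool} {p : PhasePoint} :
    IsSingular (sym g p) ↔ IsSingular p :=
  exists_congr fun _ => sym_mem_discontinuityLevel

lemma sym_mem_phaseSpace {g : Bool × Bool} {p : PhasePoint} :
    sym g p ∈ necktie.phaseSpace ↔ p ∈ necktie.phaseSpace := by
  rw [mem_phaseSpace_iff, mem_phaseSpace_iff, sym_mem_maximalPhaseSpace, sym_isSingular, swap_sym,
    sym_isSingular]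

lemma IsSingular.of_billiardMap {p : PhasePoint} (hp : p ∈ necktie.maximalPhaseSpace)
    (h : IsSingular (necktie.billiardMap p)) : IsSingular p :=
  h.elim fun i hi => ⟨i + 1, hp, hi⟩

lemma billiardMap_mem_product {p : PhasePoint} (hp : p ∈ necktie.maximalPhaseSpace) :
    necktie.billiardMap p ∈ necktie.product := by
  obtain ⟨hp, z, hz⟩ := mem_maximalPhaseSpace_iff.1 hp
  rw [billiardMap_eq hp hz, mem_product_iff]
  simpa using ⟨(mem_product_iff.1 hp).2, hz.1⟩

lemma isSingular_of_secondIsVertex {p : PhasePoint} (hp : p ∈ necktie.product)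
    (h : necktie.SecondIsVertex p) : IsSingular p := ⟨0, hp, h⟩

lemma swap_mem_product {p : PhasePoint} (hp : p ∈ necktie.product) :
    swap p ∈ necktie.product := by
  rw [mem_product_iff] at hp ⊢
  simpa [swap] using hp.symm

section Steps

/-! ### The phase points up to symmetry

Up to the symmetries there are six combinatorial types of phase points. The parameter `u` gives the
position on the kite and the parameter `t` the position on the square. The names tell the edges of
the two points, the kite having a top edge, on which `y = 2`, and a lower edge, on which
`x - 3 = 2 y`. -/

noncomputable def topRight (u t : ℝ) : PhasePoint := ⟨true, (3 + u, 2), (2, 2 - 2 * t)⟩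

noncomputable def leftTop (u t : ℝ) : PhasePoint := ⟨false, (0, 2 - 2 * t), (3 + u, 2)⟩

noncomputable def rightLower (u t : ℝ) : PhasePoint := ⟨false, (2, 2 - 2 * t), (3 + u, u / 2)⟩

noncomputable def lowerLeft (u t : ℝ) : PhasePoint := ⟨true, (3 + u, u / 2), (0, 2 - 2 * t)⟩

noncomputable def lowerBottom (u t : ℝ) : PhasePoint := ⟨true, (3 + u, u / 2), (2 * t, 0)⟩

noncomputable def bottomLower (u t : ℝ) : PhasePoint := ⟨false, (2 - 2 * t, 0), (3 + u, u / 2)⟩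

/-- One step of the billiard map inside of the maximal phase space. -/
def Step (p q : PhasePoint) : Prop :=
  p ∈ necktie.maximalPhaseSpace ∧ necktie.billiardMap p = q

lemma Step.sym {p q : PhasePoint} (g : Bool × Bool) (h : Step p q) : Step (sym g p) (sym g q) :=
  ⟨sym_mem_maximalPhaseSpace.2 h.1, by rw [billiardMap_sym, h.2]⟩

lemma step_of_reflects {p : PhasePoint} {z : Plane} (hp : p ∈ necktie.product)
    (hz : Reflects p z) : Step p ⟨!p.sign, p.y, z⟩ :=
  ⟨mem_maximalPhaseSpace_iff.2 ⟨hp, z, hz⟩, billiardMap_eq hp hz⟩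

variable {u t : ℝ}

lemma step_topRight (hu : 1 < u) (hu' : u < 2) (ht : 0 < t) (ht' : t < 1) :
    Step (topRight u t) (rightLower u t) := by
  refine step_of_reflects (z := (3 + u, u / 2)) ?_ ?_ <;>
    simp [mem_product_iff, topRight, Reflects, Parallel, mem_region_true, mem_region_false,
      mem_inner_true, mem_inner_false] <;> grind

lemma step_leftTop (hu : 1 < u) (hu' : u < 2) (ht : 0 < t) (ht' : t < 1) :
    Step (leftTop u t) (topRight u t) := by
  refine step_of_reflects (z := (2, 2 - 2 * t)) ?_ ?_ <;>
    simp [mem_product_iff, leftTop, Reflects, Parallel, mem_region_true, mem_region_false,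
      mem_inner_true, mem_inner_false] <;> grind

/-- A chord of slope 1/2 descends by 1 across the square, so `t = 1 / 2` separates the chords ending
on the left side from those ending on the bottom. The value 1/2 is admitted: there the chord ends in
the corner. -/
lemma step_rightLower_of_le_half (hu : 0 < u) (hu' : u < 2) (ht : 0 < t) (ht' : t ≤ 1 / 2) :
    Step (rightLower u t) (lowerLeft u (t + 1 / 2)) := by
  refine step_of_reflects (z := (0, 2 - 2 * (t + 1 / 2))) ?_ ?_ <;>
    simp [mem_product_iff, rightLower, Reflects, Parallel, mem_region_true, mem_region_false,
      mem_inner_true, mem_inner_false] <;> grind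

lemma step_rightLower_of_half_lt (hu : 0 < u) (hu' : u < 2) (ht : 1 / 2 < t) (ht' : t < 1) :
    Step (rightLower u t) (lowerBottom u (2 * t - 1)) := by
  refine step_of_reflects (z := (2 * (2 * t - 1), 0)) ?_ ?_ <;>
    simp [mem_product_iff, rightLower, Reflects, Parallel, mem_region_true, mem_region_false,
      mem_inner_true, mem_inner_false] <;> grind

lemma step_lowerBottom (hu : 0 < u) (hu' : u < 2) (ht : 0 < t) (ht' : t < 1) :
    Step (lowerBottom u t) (sym (true, true) (rightLower (u / 2) t)) := by
  have h : sym (true, true) (rightLower (u / 2) t) = ⟨false, (2 * t, 0), (3 + u / 4, u / 2)⟩ := by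
    simp [sym, rightLower, tableSym]; ring
  rw [h]
  refine step_of_reflects (z := (3 + u / 4, u / 2)) ?_ ?_ <;>
    simp [mem_product_iff, lowerBottom, Reflects, Parallel, mem_region_true, mem_region_false,
      mem_inner_true, mem_inner_false] <;> grind

/-- A vertical chord from the lower edge ends on the top edge for `u > 1`, on the left edge for `u <
1`, and at `w₁` for `u = 1`. -/
lemma step_lowerLeft_of_one_le (hu : 1 ≤ u) (hu' : u < 2) (ht : 0 < t) (ht' : t < 1) :
    Step (lowerLeft u t) (leftTop u t) := by
  refine step_of_reflects (z := (3 + u, 2)) ?_ ?_ <;>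
    simp [mem_product_iff, lowerLeft, Reflects, Parallel, mem_region_true, mem_region_false,
      mem_inner_true, mem_inner_false] <;> grind

lemma step_lowerLeft_of_lt_one (hu : 0 < u) (hu' : u < 1) (ht : 0 < t) (ht' : t < 1) :
    Step (lowerLeft u t) (sym (false, true) (bottomLower (2 * u) t)) := by
  have h : sym (false, true) (bottomLower (2 * u) t) =
      ⟨false, (0, 2 - 2 * t), (3 + u, 2 * u)⟩ := by
    simp [sym, bottomLower, tableSym]; ring
  rw [h]
  refine step_of_reflects (z := (3 + u, 2 * u)) ?_ ?_ <;>
    simp [mem_product_iff, lowerLeft, Reflects, Parallel, mem_region_true, mem_region_false,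
      mem_inner_true, mem_inner_false] <;> grind

lemma step_bottomLower (hu : 0 < u) (hu' : u < 2) (ht : 0 < t) (ht' : t < 1) :
    Step (bottomLower u t) (sym (true, false) (lowerLeft u (t / 2))) := by
  have h : sym (true, false) (lowerLeft u (t / 2)) = ⟨true, (3 + u, u / 2), (2, t)⟩ := by
    simp [sym, lowerLeft, tableSym]; ring
  rw [h]
  refine step_of_reflects (z := (2, t)) ?_ ?_ <;>
    simp [mem_product_iff, bottomLower, Reflects, Parallel, mem_region_true, mem_region_false,
      mem_inner_true, mem_inner_false] <;> grind

end Steps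

/-! ### Invariant sets of parameters, and bijectivity on the phase space -/

section States

/-- The phase points of the six types with parameters in given sets, and their images under the
symmetries. -/
inductive IsState (U T : Set ℝ) : PhasePoint → Prop
  | topRight (g : Bool × Bool) {u t : ℝ} (hu : u ∈ U) (hu' : 1 < u) (ht : t ∈ T) :
      IsState U T (sym g (topRight u t))
  | leftTop (g : Bool × Bool) {u t : ℝ} (hu : u ∈ U) (hu' : 1 < u) (ht : t ∈ T) :
      IsState U T (sym g (leftTop u t))
  | rightLower (g : Bool × Bool) {u t : ℝ} (hu : u ∈ U) (ht : t ∈ T) :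
      IsState U T (sym g (rightLower u t))
  | lowerLeft (g : Bool × Bool) {u t : ℝ} (hu : u ∈ U) (ht : t ∈ T) :
      IsState U T (sym g (lowerLeft u t))
  | lowerBottom (g : Bool × Bool) {u t : ℝ} (hu : u ∈ U) (ht : t ∈ T) :
      IsState U T (sym g (lowerBottom u t))
  | bottomLower (g : Bool × Bool) {u t : ℝ} (hu : u ∈ U) (ht : t ∈ T) :
      IsState U T (sym g (bottomLower u t))

/-- Sets of parameters that the billiard map can leave only by hitting a vertex. -/
structure ParameterInvariant (U T : Set ℝ) : Prop where
  subset_left : U ⊆ Set.Ioo 0 2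
  subset_right : T ⊆ Set.Ioo 0 1
  half_left {u : ℝ} : u ∈ U → u / 2 ∈ U
  double_left {u : ℝ} : u ∈ U → u < 1 → 2 * u ∈ U
  half_right {t : ℝ} : t ∈ T → t / 2 ∈ T
  add_half_right {t : ℝ} : t ∈ T → t < 1 / 2 → t + 1 / 2 ∈ T
  double_right {t : ℝ} : t ∈ T → 1 / 2 < t → 2 * t - 1 ∈ T
  one_sub_right {t : ℝ} : t ∈ T → 1 - t ∈ T

variable {U T : Set ℝ}

lemma swap_topRight (u t : ℝ) : swap (topRight u t) = sym (true, false) (leftTop u (1 - t)) := by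
  simp [swap, topRight, leftTop, sym, tableSym]; ring

lemma swap_leftTop (u t : ℝ) : swap (leftTop u t) = sym (true, false) (topRight u (1 - t)) := by
  simp [swap, topRight, leftTop, sym, tableSym]; ring

lemma swap_rightLower (u t : ℝ) :
    swap (rightLower u t) = sym (true, false) (lowerLeft u (1 - t)) := by
  simp [swap, rightLower, lowerLeft, sym, tableSym]; ring

lemma swap_lowerLeft (u t : ℝ) :
    swap (lowerLeft u t) = sym (true, false) (rightLower u (1 - t)) := by
  simp [swap, rightLower, lowerLeft, sym, tableSym]; ring

lemma swap_lowerBottom (u t : ℝ) : swap (lowerBottom u t) = bottomLower u (1 - t) := by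
  simp [swap, lowerBottom, bottomLower]; ring

lemma swap_bottomLower (u t : ℝ) : swap (bottomLower u t) = lowerBottom u (1 - t) := by
  simp [swap, lowerBottom, bottomLower]; ring

lemma IsState.swap (h : ParameterInvariant U T) {p : PhasePoint} (hp : IsState U T p) :
    IsState U T (swap p) := by
  cases hp with
  | topRight g hu hu' ht =>
    rw [swap_sym, swap_topRight, sym_sym]
    exact .leftTop _ hu hu' (h.one_sub_right ht)
  | leftTop g hu hu' ht =>
    rw [swap_sym, swap_leftTop, sym_sym]
    exact .topRight _ hu hu' (h.one_sub_right ht)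
  | rightLower g hu ht =>
    rw [swap_sym, swap_rightLower, sym_sym]
    exact .lowerLeft _ hu (h.one_sub_right ht)
  | lowerLeft g hu ht =>
    rw [swap_sym, swap_lowerLeft, sym_sym]
    exact .rightLower _ hu (h.one_sub_right ht)
  | lowerBottom g hu ht =>
    rw [swap_sym, swap_lowerBottom]
    exact .bottomLower _ hu (h.one_sub_right ht)
  | bottomLower g hu ht =>
    rw [swap_sym, swap_bottomLower]
    exact .lowerBottom _ hu (h.one_sub_right ht)

lemma secondIsVertex_lowerLeft_one (u : ℝ) : necktie.SecondIsVertex (lowerLeft u 1) := by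
  rw [secondIsVertex_iff]
  simp [lowerLeft]

lemma secondIsVertex_leftTop_one (t : ℝ) : necktie.SecondIsVertex (leftTop 1 t) := by
  rw [secondIsVertex_iff]
  simp [leftTop]
  norm_num

/-- A step of the billiard map either stays in an invariant set of parameters, or ends in a
vertex. -/
lemma IsState.step (h : ParameterInvariant U T) {p : PhasePoint} (hp : IsState U T p) :
    p ∈ necktie.maximalPhaseSpace ∧
      (IsState U T (necktie.billiardMap p) ∨
        necktie.SecondIsVertex (necktie.billiardMap p) ∧ (1 ∈ U ∨ 1 / 2 ∈ T)) := by
  suffices ∃ q, Step p q ∧ (IsState U T q ∨ necktie.SecondIsVertex q ∧ (1 ∈ U ∨ 1 / 2 ∈ T)) by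
    obtain ⟨q, ⟨hp, rfl⟩, hq⟩ := this
    exact ⟨hp, hq⟩
  cases hp with
  | topRight g hu hu' ht =>
    exact ⟨_, (step_topRight hu' (h.subset_left hu).2 (h.subset_right ht).1
      (h.subset_right ht).2).sym g, .inl (.rightLower g hu ht)⟩
  | leftTop g hu hu' ht =>
    exact ⟨_, (step_leftTop hu' (h.subset_left hu).2 (h.subset_right ht).1
      (h.subset_right ht).2).sym g, .inl (.topRight g hu hu' ht)⟩
  | @rightLower g u t hu ht =>
    rcases lt_or_ge (1 / 2) t with h' | h'
    · exact ⟨_, (step_rightLower_of_half_lt (h.subset_left hu).1 (h.subset_left hu).2 h'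
        (h.subset_right ht).2).sym g, .inl (.lowerBottom g hu (h.double_right ht h'))⟩
    refine ⟨_, (step_rightLower_of_le_half (h.subset_left hu).1 (h.subset_left hu).2
      (h.subset_right ht).1 h').sym g, ?_⟩
    -- At `t = 1 / 2` the chord ends, up to symmetry, in the corner `(0,0)` of the square.
    rcases h'.lt_or_eq with h' | rfl
    · exact .inl (.lowerLeft g hu (h.add_half_right ht h'))
    · refine .inr ⟨?_, .inr ht⟩
      rw [sym_secondIsVertex, add_halves]
      exact secondIsVertex_lowerLeft_one u
  | @lowerLeft g u t hu ht =>
    rcases lt_or_ge u 1 with h' | h'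
    · refine ⟨_, (step_lowerLeft_of_lt_one (h.subset_left hu).1 h' (h.subset_right ht).1
        (h.subset_right ht).2).sym g, .inl ?_⟩
      rw [sym_sym]
      exact .bottomLower _ (h.double_left hu h') ht
    refine ⟨_, (step_lowerLeft_of_one_le h' (h.subset_left hu).2 (h.subset_right ht).1
      (h.subset_right ht).2).sym g, ?_⟩
    -- At `u = 1` the chord ends, up to symmetry, in the vertex `w₁` of the kite.
    rcases h'.lt_or_eq with h' | rfl
    · exact .inl (.leftTop g hu h' ht)
    · exact .inr ⟨sym_secondIsVertex.2 (secondIsVertex_leftTop_one t), .inl hu⟩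
  | lowerBottom g hu ht =>
    refine ⟨_, (step_lowerBottom (h.subset_left hu).1 (h.subset_left hu).2 (h.subset_right ht).1
      (h.subset_right ht).2).sym g, .inl ?_⟩
    rw [sym_sym]
    exact .rightLower _ (h.half_left hu) ht
  | bottomLower g hu ht =>
    refine ⟨_, (step_bottomLower (h.subset_left hu).1 (h.subset_left hu).2 (h.subset_right ht).1
      (h.subset_right ht).2).sym g, .inl ?_⟩
    rw [sym_sym]
    exact .lowerLeft _ hu (h.half_right ht)

lemma parameterInvariant_Ioo : ParameterInvariant (Set.Ioo 0 2) (Set.Ioo 0 1) where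
  subset_left := subset_rfl
  subset_right := subset_rfl
  half_left h := by constructor <;> linarith [h.1, h.2]
  double_left h _ := by constructor <;> linarith [h.1, h.2]
  half_right h := by constructor <;> linarith [h.1, h.2]
  add_half_right h _ := by constructor <;> linarith [h.1, h.2]
  double_right h _ := by constructor <;> linarith [h.1, h.2]
  one_sub_right h := by constructor <;> linarith [h.1, h.2]

/-- The pairs of points on nonparallel open edges of the two tables. -/
abbrev IsRegular : PhasePoint → Prop := IsState (Set.Ioo 0 2) (Set.Ioo 0 1)

/-- The last two hypotheses exclude the four pairs of parallel edges. The other twelve pairs are the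
images of `topRight`, `lowerLeft` and `lowerBottom` under the four symmetries. -/
lemma isRegular_of_transversal {x y : Plane}
    (hx : (x.2 = 2 ∧ 4 < x.1 ∧ x.1 < 5) ∨ (x.1 = 5 ∧ 1 < x.2 ∧ x.2 < 2) ∨
      (x.2 = 2 * (x.1 - 3) ∧ 3 < x.1 ∧ x.1 < 4) ∨ (x.1 - 3 = 2 * x.2 ∧ 3 < x.1 ∧ x.1 < 5))
    (hy : ((y.1 = 0 ∨ y.1 = 2) ∧ 0 < y.2 ∧ y.2 < 2) ∨ ((y.2 = 0 ∨ y.2 = 2) ∧ 0 < y.1 ∧ y.1 < 2))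
    (h : ¬ (x.2 = 2 ∧ (y.2 = 0 ∨ y.2 = 2))) (h' : ¬ (x.1 = 5 ∧ (y.1 = 0 ∨ y.1 = 2))) :
    IsRegular ⟨true, x, y⟩ := by
  obtain ⟨x1, x2⟩ := x
  obtain ⟨y1, y2⟩ := y
  simp only at hx hy h h'
  have main : ∀ {p q : PhasePoint}, IsRegular p → q = p → IsRegular q := by
    rintro p q hp rfl; exact hp
  rcases hx with hx | hx | hx | hx <;> rcases hy with ⟨hy | hy, hy'⟩ | ⟨hy | hy, hy'⟩
  · exact main (.topRight (true, false) (u := x1 - 3) (t := y2 / 2)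
      (by constructor <;> linarith) (by linarith) (by constructor <;> linarith))
      (by simp [sym, topRight, tableSym]; grind)
  · exact main (.topRight (false, false) (u := x1 - 3) (t := 1 - y2 / 2)
      (by constructor <;> linarith) (by linarith) (by constructor <;> linarith))
      (by simp [sym, topRight, tableSym]; grind)
  · grind
  · grind
  · grind
  · grind
  · exact main (.topRight (true, true) (u := x2) (t := y1 / 2)
      (by constructor <;> linarith) (by linarith) (by constructor <;> linarith))
      (by simp [sym, topRight, tableSym]; grind)
  · exact main (.topRight (false, true) (u := x2) (t := 1 - y1 / 2)
      (by constructor <;> linarith) (by linarith) (by constructor <;> linarith))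
      (by simp [sym, topRight, tableSym]; grind)
  · exact main (.lowerBottom (false, true) (u := x2) (t := y2 / 2)
      (by constructor <;> linarith) (by constructor <;> linarith))
      (by simp [sym, lowerBottom, tableSym]; grind)
  · exact main (.lowerBottom (true, true) (u := x2) (t := 1 - y2 / 2)
      (by constructor <;> linarith) (by constructor <;> linarith))
      (by simp [sym, lowerBottom, tableSym]; grind)
  · exact main (.lowerLeft (false, true) (u := x2) (t := 1 - y1 / 2)
      (by constructor <;> linarith) (by constructor <;> linarith))
      (by simp [sym, lowerLeft, tableSym]; grind)
  · exact main (.lowerLeft (true, true) (u := x2) (t := y1 / 2)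
      (by constructor <;> linarith) (by constructor <;> linarith))
      (by simp [sym, lowerLeft, tableSym]; grind)
  · exact main (.lowerLeft (false, false) (u := x1 - 3) (t := 1 - y2 / 2)
      (by constructor <;> linarith) (by constructor <;> linarith))
      (by simp [sym, lowerLeft, tableSym]; grind)
  · exact main (.lowerLeft (true, false) (u := x1 - 3) (t := y2 / 2)
      (by constructor <;> linarith) (by constructor <;> linarith))
      (by simp [sym, lowerLeft, tableSym]; grind)
  · exact main (.lowerBottom (false, false) (u := x1 - 3) (t := y1 / 2)
      (by constructor <;> linarith) (by constructor <;> linarith))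
      (by simp [sym, lowerBottom, tableSym]; grind)
  · exact main (.lowerBottom (true, false) (u := x1 - 3) (t := 1 - y1 / 2)
      (by constructor <;> linarith) (by constructor <;> linarith))
      (by simp [sym, lowerBottom, tableSym]; grind)

/-- `Parallel` puts `p.y` on an open edge and `hv` keeps `p.x` off the vertices. If the two edges
were parallel, the chord from `p.x` would run along the line of its own edge, and its midpoint would
not be interior. -/
lemma isRegular_of_mem_maximalPhaseSpace {p : PhasePoint} (hp : p ∈ necktie.maximalPhaseSpace)
    (hv : ¬ necktie.SecondIsVertex (swap p)) : IsRegular p := by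
  obtain ⟨hp, z, hz, hpar, hin⟩ := mem_maximalPhaseSpace_iff.1 hp
  have hx := (mem_product_iff.1 hp).1
  rw [secondIsVertex_iff] at hv
  obtain ⟨s, ⟨x1, x2⟩, ⟨y1, y2⟩⟩ := p
  obtain ⟨z1, z2⟩ := z
  cases s
  · refine IsState.swap parameterInvariant_Ioo (p := ⟨true, (y1, y2), (x1, x2)⟩) ?_
    simp [swap, mem_region_false, mem_inner_false, Parallel] at hx hv hz hpar hin
    refine isRegular_of_transversal ?_ ?_ ?_ ?_ <;> simp
    · grind
    · clear hpar hz hin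
      grind
    · clear hx hv hz
      rcases hpar with h | h | h | h <;> grind
    · clear hx hv hz
      rcases hpar with h | h | h | h <;> grind
  · simp [swap, mem_region_true, mem_inner_true, Parallel] at hx hv hz hpar hin
    refine isRegular_of_transversal ?_ ?_ ?_ ?_ <;> simp
    · clear hpar hz hin
      have hx' : x2 = 2 ∨ x1 = 5 ∨ x2 = 2 * (x1 - 3) ∨ x1 - 3 = 2 * x2 := by grind
      obtain ⟨⟨h1, h2, h3, h4⟩, -⟩ := hx
      obtain ⟨v1, v2, v3, v4⟩ := hv
      rcases hx' with h | h | h | h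
      · exact .inl ⟨h, by grind, by grind⟩
      · exact .inr (.inl ⟨h, by grind, by grind⟩)
      · exact .inr (.inr (.inl ⟨h, lt_of_le_of_ne (by linarith) fun e => v3 e.symm (by linarith),
          lt_of_le_of_ne (by linarith) fun e => v2 e (by linarith)⟩))
      · exact .inr (.inr (.inr ⟨h, lt_of_le_of_ne (by linarith) fun e => v3 e.symm (by linarith),
          lt_of_le_of_ne h2 fun e => v4 e (by linarith)⟩))
    · clear hx hv hz hin
      grind
    · clear hx hv hz
      rcases hpar with h | h <;> grind
    · clear hx hv hz
      rcases hpar with h | h <;> grind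

lemma isRegular_of_mem_phaseSpace {p : PhasePoint} (hp : p ∈ necktie.phaseSpace) :
    IsRegular p := by
  rw [mem_phaseSpace_iff] at hp
  exact isRegular_of_mem_maximalPhaseSpace hp.1 fun h =>
    hp.2.2 (isSingular_of_secondIsVertex (swap_mem_product (mem_maximalPhaseSpace_iff.1 hp.1).1) h)

lemma swap_mem_phaseSpace {p : PhasePoint} (hp : p ∈ necktie.phaseSpace) :
    swap p ∈ necktie.phaseSpace := by
  have h := ((isRegular_of_mem_phaseSpace hp).swap parameterInvariant_Ioo).step
    parameterInvariant_Ioo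
  rw [mem_phaseSpace_iff] at hp ⊢
  rw [swap_swap]
  exact ⟨h.1, hp.2.2, hp.2.1⟩

lemma mapsTo_phaseSpace :
    Set.MapsTo necktie.billiardMap necktie.phaseSpace necktie.phaseSpace := by
  intro p hp
  have h := (isRegular_of_mem_phaseSpace hp).step parameterInvariant_Ioo
  rw [mem_phaseSpace_iff] at hp ⊢
  have hns : ¬ IsSingular (necktie.billiardMap p) := fun h' => hp.2.1 (.of_billiardMap hp.1 h')
  have hprod := billiardMap_mem_product hp.1
  rcases h.2 with h' | h'
  swap
  · exact absurd (isSingular_of_secondIsVertex hprod h'.1) hns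
  have h' := (h'.step parameterInvariant_Ioo).1
  refine ⟨h', hns, ?_⟩
  -- At level 0 the vertex would be `p.y` itself; at level `i + 1`, reversibility would put `swap p`
  -- at level `i`.
  rintro ⟨_ | i, hi⟩
  · obtain ⟨hp', z, hz⟩ := mem_maximalPhaseSpace_iff.1 hp.1
    have hv := hi.2
    rw [billiardMap_eq hp' hz, secondIsVertex_iff] at hv
    exact hp.1.2.1 (secondIsVertex_iff.2 (by simpa [swap] using hv))
  · refine hp.2.2 ⟨i, ?_⟩
    rw [← (billiardMap_swap_billiardMap hp.1).2]
    exact hi.2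

/-- By reversibility, conjugating the map with `swap` gives its inverse. -/
lemma bijOn_phaseSpace :
    Set.BijOn necktie.billiardMap necktie.phaseSpace necktie.phaseSpace := by
  have key : ∀ p ∈ necktie.phaseSpace,
      necktie.billiardMap (swap (necktie.billiardMap p)) = swap p :=
    fun p hp => (billiardMap_swap_billiardMap (mem_phaseSpace_iff.1 hp).1).2
  refine ⟨mapsTo_phaseSpace, fun p hp q hq hpq => ?_, fun q hq => ?_⟩
  · rw [← swap_swap p, ← key p hp, hpq, key q hq, swap_swap]
  · refine ⟨swap (necktie.billiardMap (swap q)),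
      swap_mem_phaseSpace (mapsTo_phaseSpace (swap_mem_phaseSpace hq)), ?_⟩
    rw [key _ (swap_mem_phaseSpace hq), swap_swap]

end States

/-! ### Dyadic rationals -/

lemma IsDyadic.sub {s t : ℝ} (hs : IsDyadic s) (ht : IsDyadic t) : IsDyadic (s - t) := by
  obtain ⟨k, n, rfl⟩ := hs
  obtain ⟨l, m, rfl⟩ := ht
  refine ⟨k * 2 ^ m - l * 2 ^ n, n + m, ?_⟩
  push_cast
  rw [pow_add]
  field_simp

lemma isDyadic_intCast (k : ℤ) : IsDyadic k := ⟨k, 0, by simp⟩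

lemma isDyadic_one : IsDyadic 1 := by simpa using isDyadic_intCast 1

lemma isDyadic_half : IsDyadic (1 / 2) := ⟨1, 1, by simp⟩

lemma isDyadic_half_iff {t : ℝ} : IsDyadic (t / 2) ↔ IsDyadic t := by
  constructor
  · rintro ⟨k, n, h⟩
    refine ⟨2 * k, n, ?_⟩
    push_cast
    rw [mul_div_assoc, ← h]
    ring
  · rintro ⟨k, n, rfl⟩
    exact ⟨k, n + 1, by rw [pow_succ, div_div]⟩

/-- The numbers in the unit interval that are not dyadic. -/
def nonDyadic : Set ℝ := {t | t ∈ Set.Ioo 0 1 ∧ ¬ IsDyadic t}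

/-! ### The odometer -/

/-- Prepend a digit to a sequence of digits. -/
def prepend (b : Fin 2) (a : ℕ → Fin 2) : ℕ → Fin 2
  | 0 => b
  | i + 1 => a i

lemma odometer_prepend_zero (a : ℕ → Fin 2) : odometer (prepend 0 a) = prepend 1 a := by
  funext i
  cases i with
  | zero => simp [odometer, prepend]
  | succ i =>
    rw [odometer, if_neg fun h => by simpa [prepend] using h 0 i.succ_pos]
    rfl

lemma odometer_prepend_one (a : ℕ → Fin 2) :
    odometer (prepend 1 a) = prepend 0 (odometer a) := by
  funext i
  cases i with
  | zero => simp [odometer, prepend]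
  | succ i =>
    have h : (∀ j < i + 1, prepend 1 a j = 1) ↔ ∀ j < i, a j = 1 := by
      refine ⟨fun h j hj => h (j + 1) (by omega), fun h j hj => ?_⟩
      cases j with
      | zero => rfl
      | succ j => exact h j (by omega)
    change (if ∀ j < i + 1, prepend 1 a j = 1 then 1 - a i else a i) = _
    simp only [h]
    rfl

lemma exists_eq_prepend (a : ℕ → Fin 2) : ∃ b c, a = prepend b c :=
  ⟨a 0, fun i => a (i + 1), by funext i; cases i <;> rfl⟩

lemma prepend_inj {b c : Fin 2} {a d : ℕ → Fin 2} (h : prepend b a = prepend c d) :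
    b = c ∧ a = d :=
  ⟨congrFun h 0, funext fun i => congrFun h (i + 1)⟩

/-- Of two consecutive additions, exactly one carries past the first digit. -/
lemma odometer_odometer_prepend (b : Fin 2) (a : ℕ → Fin 2) :
    odometer (odometer (prepend b a)) = prepend b (odometer a) := by
  fin_cases b
  · simp [odometer_prepend_zero, odometer_prepend_one]
  · simp [odometer_prepend_zero, odometer_prepend_one]

lemma odometer_iterate_prepend (b : Fin 2) (m : ℕ) (a : ℕ → Fin 2) :
    odometer^[2 * m] (prepend b a) = prepend b (odometer^[m] a) := by
  rw [Function.iterate_mul]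
  exact (show Function.Semiconj (prepend b) odometer odometer^[2] from
    fun a => (odometer_odometer_prepend b a).symm).iterate_right m a |>.symm

/-- An odd iterate flips the first digit; the iterate of order `2 * m` is the iterate of order `m`
on the tail, so a period could be halved. -/
lemma odometer_iterate_ne {n : ℕ} (hn : 0 < n) (a : ℕ → Fin 2) : odometer^[n] a ≠ a := by
  induction n using Nat.strong_induction_on generalizing a with
  | _ n ih =>
    obtain ⟨b, c, rfl⟩ := exists_eq_prepend a
    rcases Nat.even_or_odd' n with ⟨m, rfl | rfl⟩
    · rw [odometer_iterate_prepend]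
      exact fun h => ih m (by omega) (by omega) c (prepend_inj h).2
    · rw [Function.iterate_succ_apply', odometer_iterate_prepend]
      intro h
      have h0 := congrFun h 0
      simp only [odometer, prepend] at h0
      revert h0
      fin_cases b <;> simp

lemma notMem_periodicPts_odometer (a : ℕ → Fin 2) : a ∉ Function.periodicPts odometer := by
  rintro ⟨n, hn, h⟩
  exact odometer_iterate_ne hn a h

/-! ### Adding one as a relation on real numbers -/

/-- `t'` arises from `t` by adding one to the binary expansion, with `l` carries. -/
inductive AddOne : ℕ → ℝ → ℝ → Prop
  | zero {t : ℝ} (h : 0 < t) (h' : t < 1 / 2) : AddOne 0 t (t + 1 / 2)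
  | succ {l : ℕ} {t t' : ℝ} (h : AddOne l t t') : AddOne (l + 1) ((1 + t) / 2) (t' / 2)

lemma AddOne.mem_Ioo {l : ℕ} {t t' : ℝ} (h : AddOne l t t') :
    t ∈ Set.Ioo (0 : ℝ) 1 ∧ t' ∈ Set.Ioo (0 : ℝ) 1 := by
  induction h with
  | zero h h' => exact ⟨⟨h, by linarith⟩, by linarith, by linarith⟩
  | succ _ ih =>
    obtain ⟨⟨h1, h2⟩, h3, h4⟩ := ih
    exact ⟨⟨by linarith, by linarith⟩, by linarith, by linarith⟩

lemma AddOne.not_isDyadic {l : ℕ} {t t' : ℝ} (h : AddOne l t t') (ht : ¬ IsDyadic t) :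
    ¬ IsDyadic t' := by
  induction h with
  | zero h h' => exact fun h => ht (by simpa using h.sub isDyadic_half)
  | @succ l t t' h ih =>
    rw [isDyadic_half_iff] at ht ⊢
    refine ih fun h => ht ?_
    have := h.sub (isDyadic_intCast (-1))
    rwa [Int.cast_neg, Int.cast_one, sub_neg_eq_add, add_comm] at this

lemma addOne_of_mem {l : ℕ} {t : ℝ}
    (ht : t ∈ Set.Ioo (1 - (1 / 2 : ℝ) ^ l) (1 - (1 / 2 : ℝ) ^ (l + 1))) :
    AddOne l t (t - 1 + (1 / 2 : ℝ) ^ l + (1 / 2 : ℝ) ^ (l + 1)) := by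
  induction l generalizing t with
  | zero =>
    norm_num at ht
    have := AddOne.zero ht.1 (by linarith)
    convert this using 1
    norm_num
  | succ l ih =>
    -- Removing a leading digit 1 maps the interval for `l + 1` carries onto the one for `l`.
    have h := ih (t := 2 * t - 1) (by
      have e := pow_succ (1 / 2 : ℝ) l
      have e' := pow_succ (1 / 2 : ℝ) (l + 1)
      constructor <;> linarith [ht.1, ht.2])
    convert h.succ using 1 <;> ring

lemma exists_addOne {t : ℝ} (ht : t ∈ nonDyadic) : ∃ l t', AddOne l t t' := by
  obtain ⟨n, hn⟩ := exists_pow_lt_of_lt_one (sub_pos.2 ht.1.2) (one_half_lt_one (α := ℝ))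
  replace hn : t < 1 - (1 / 2) ^ n := by linarith
  induction n generalizing t with
  | zero => simp at hn; exact absurd ht.1.1 (by linarith)
  | succ n ih =>
    rcases lt_trichotomy t (1 / 2) with h | rfl | h
    · exact ⟨_, _, .zero ht.1.1 h⟩
    · exact absurd isDyadic_half ht.2
    · have hd : ¬ IsDyadic (2 * t - 1) := fun hd => ht.2 <| by
        have := isDyadic_half_iff.2 (hd.sub (isDyadic_intCast (-1)))
        convert this using 1
        push_cast
        ring
      obtain ⟨l, t', h'⟩ := ih ⟨⟨by linarith, by linarith [ht.1.2]⟩, hd⟩ (by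
        rw [pow_succ] at hn
        linarith)
      refine ⟨l + 1, t' / 2, ?_⟩
      convert h'.succ using 1
      ring

lemma digits_half {t : ℝ} (h : t < 1) :
    Real.digits (t / 2) 2 = prepend 0 (Real.digits t 2) := by
  funext i
  cases i with
  | zero =>
    have : ⌊t⌋₊ = 0 := Nat.floor_eq_zero.2 h
    simp [Real.digits, prepend, this]
  | succ i =>
    simp only [Real.digits, prepend]
    congr 2
    push_cast
    ring

lemma digits_one_add_half {t : ℝ} (h : 0 ≤ t) (h' : t < 1) :
    Real.digits ((1 + t) / 2) 2 = prepend 1 (Real.digits t 2) := by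
  funext i
  cases i with
  | zero =>
    have : ⌊1 + t⌋₊ = 1 := by
      rw [Nat.floor_eq_iff (by linarith)]
      norm_num
      exact ⟨h, by linarith⟩
    simp [Real.digits, prepend, this]
  | succ i =>
    simp only [Real.digits, prepend]
    -- The leading digit only adds an even integer, which is invisible modulo 2.
    have e : (1 + t) / 2 * ((2 : ℕ) : ℝ) ^ (i + 1 + 1) =
        t * ((2 : ℕ) : ℝ) ^ (i + 1) + ((2 * 2 ^ i : ℕ) : ℝ) := by
      push_cast; ring
    rw [e, Nat.floor_add_natCast (by positivity)]
    ext
    simp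

lemma AddOne.odometer_digits {l : ℕ} {t t' : ℝ} (h : AddOne l t t') :
    odometer (Real.digits t 2) = Real.digits t' 2 := by
  induction h with
  | @zero t _ _ =>
    have e : t = (2 * t) / 2 := by ring
    have e' : t + 1 / 2 = (1 + 2 * t) / 2 := by ring
    rw [e', digits_one_add_half (by linarith) (by linarith)]
    nth_rw 1 [e]
    rw [digits_half (by linarith), odometer_prepend_zero]
  | @succ l t t' h ih =>
    obtain ⟨ht, ht'⟩ := h.mem_Ioo
    rw [digits_one_add_half ht.1.le ht.2, digits_half ht'.2, odometer_prepend_one, ih]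

lemma AddOne.vonNeumannKakutani_eq {l : ℕ} {t t' : ℝ} (h : AddOne l t t') :
    vonNeumannKakutani t = t' := by
  rw [vonNeumannKakutani, h.odometer_digits,
    Real.ofDigits_digits one_lt_two (Set.Ioo_subset_Ico_self h.mem_Ioo.2)]

lemma AddOne.mem_nonDyadic {l : ℕ} {t t' : ℝ} (h : AddOne l t t') (ht : t ∈ nonDyadic) :
    t' ∈ nonDyadic :=
  ⟨h.mem_Ioo.2, h.not_isDyadic ht.2⟩

lemma digits_vonNeumannKakutani_iterate {t : ℝ} (ht : t ∈ nonDyadic) (n : ℕ) :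
    vonNeumannKakutani^[n] t ∈ nonDyadic ∧
      Real.digits (vonNeumannKakutani^[n] t) 2 = odometer^[n] (Real.digits t 2) := by
  induction n with
  | zero => exact ⟨ht, rfl⟩
  | succ n ih =>
    obtain ⟨l, t', h⟩ := exists_addOne ih.1
    rw [Function.iterate_succ_apply', Function.iterate_succ_apply', h.vonNeumannKakutani_eq,
      ← ih.2, h.odometer_digits]
    exact ⟨h.mem_nonDyadic ih.1, rfl⟩

lemma vonNeumannKakutani_iterate_ne {t : ℝ} (ht : t ∈ nonDyadic) {n : ℕ} (hn : 0 < n) :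
    vonNeumannKakutani^[n] t ≠ t := by
  intro h
  have := (digits_vonNeumannKakutani_iterate ht n).2
  rw [h] at this
  exact odometer_iterate_ne hn _ this.symm

/-! ### Dyadic rationals and the odometer -/

/-- The numbers `1 - 2⁻ʲ` with `j ≥ 1`, where the von Neumann–Kakutani transformation is
discontinuous. -/
inductive IsBreak : ℝ → Prop
  | half : IsBreak (1 / 2)
  | succ {t : ℝ} (h : IsBreak t) : IsBreak ((1 + t) / 2)

lemma IsBreak.mem_Ioo {t : ℝ} (h : IsBreak t) : t ∈ Set.Ioo (0 : ℝ) 1 := by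
  induction h with
  | half => norm_num
  | succ _ ih => exact ⟨by linarith [ih.1], by linarith [ih.2]⟩

/-- The numbers whose orbit under adding one ends in a discontinuity. -/
inductive HitsBreak : ℝ → Prop
  | isBreak {t : ℝ} (h : IsBreak t) : HitsBreak t
  | addOne {l : ℕ} {t t' : ℝ} (h : AddOne l t t') (h' : HitsBreak t') : HitsBreak t

/-- Adding one takes `t / 2` to `(1 + t) / 2`, so the first claim follows from the second. In turn
`(1 + t) / 2` is a break if `t` is one, and otherwise is taken to `t' / 2`, which the induction
covers. -/
lemma HitsBreak.prepend {t : ℝ} (h : HitsBreak t) :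
    HitsBreak (t / 2) ∧ HitsBreak ((1 + t) / 2) := by
  have key : ∀ {t : ℝ}, t ∈ Set.Ioo (0 : ℝ) 1 → HitsBreak ((1 + t) / 2) → HitsBreak (t / 2) := by
    intro t ht h
    refine .addOne (.zero (by linarith [ht.1]) (by linarith [ht.2])) ?_
    rwa [← add_div, add_comm]
  induction h with
  | isBreak h => exact ⟨key h.mem_Ioo (.isBreak h.succ), .isBreak h.succ⟩
  | addOne h _ ih =>
    have := HitsBreak.addOne h.succ ih.1
    exact ⟨key h.mem_Ioo.1 this, this⟩

lemma IsDyadic.hitsBreak {t : ℝ} (h : IsDyadic t) (ht : t ∈ Set.Ioo (0 : ℝ) 1) :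
    HitsBreak t := by
  obtain ⟨k, n, rfl⟩ := h
  induction n generalizing k with
  | zero =>
    obtain ⟨h0, h1⟩ := ht
    simp only [pow_zero, div_one] at h0 h1
    have h0' : 0 < k := by exact_mod_cast h0
    have h1' : k < 1 := by exact_mod_cast h1
    omega
  | succ n ih =>
    have e : (k : ℝ) / 2 ^ (n + 1) = k / 2 ^ n / 2 := by rw [pow_succ, div_div]
    rw [e] at ht ⊢
    rcases lt_trichotomy ((k : ℝ) / 2 ^ n) 1 with h | h | h
    · exact (ih k ⟨by linarith [ht.1], h⟩).prepend.1
    · rw [h]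
      exact .isBreak .half
    · have e' : (k : ℝ) / 2 ^ n = 1 + ((k - 2 ^ n : ℤ) : ℝ) / 2 ^ n := by
        push_cast
        field_simp
        ring
      rw [e'] at h ht ⊢
      exact (ih _ ⟨by linarith, by linarith [ht.2]⟩).prepend.2

/-! ### Singular and nonsingular orbits -/

lemma isSingular_of_iterate {p : PhasePoint} {n : ℕ}
    (h : IsSingular (necktie.billiardMap^[n] p)) : IsSingular p := by
  induction n generalizing p with
  | zero => exact h
  | succ n ih =>
    by_cases hp : p ∈ necktie.maximalPhaseSpace
    · exact .of_billiardMap hp (ih h)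
    · rw [Function.iterate_succ_apply] at h
      have := ih h
      -- Outside the maximal phase space the map is the identity by convention.
      rwa [PolygonPair.billiardMap, dif_neg hp] at this

lemma IsSingular.of_step {p q : PhasePoint} (h : Step p q) (hq : IsSingular q) : IsSingular p :=
  .of_billiardMap h.1 (h.2.symm ▸ hq)

lemma Step.isSingular_of_secondIsVertex {p q : PhasePoint} (h : Step p q)
    (hq : necktie.SecondIsVertex q) : IsSingular p :=
  .of_step h (SymplecticBilliards.isSingular_of_secondIsVertex
    (h.2 ▸ billiardMap_mem_product h.1) hq)

/-- The numbers in `(0, 2)` that are not powers of two. -/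
def nonPower : Set ℝ := {u | u ∈ Set.Ioo 0 2 ∧ ∀ k : ℕ, u * 2 ^ k ≠ 1}

lemma parameterInvariant_nonPower : ParameterInvariant nonPower nonDyadic where
  subset_left _ h := h.1
  subset_right _ h := h.1
  half_left {u} h := by
    refine ⟨parameterInvariant_Ioo.half_left h.1, fun k hk => ?_⟩
    -- For `k = 0` the equation would say `u = 2`, which the interval excludes.
    cases k with
    | zero => linarith [h.1.2]
    | succ k => exact h.2 k (by rw [← hk]; ring)
  double_left h h' := by
    refine ⟨parameterInvariant_Ioo.double_left h.1 h', fun k hk => h.2 (k + 1) ?_⟩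
    rw [← hk]; ring
  half_right h := ⟨parameterInvariant_Ioo.half_right h.1, mt isDyadic_half_iff.1 h.2⟩
  add_half_right h h' := (AddOne.zero h.1.1 h').mem_nonDyadic h
  double_right {t} h h' := by
    refine ⟨parameterInvariant_Ioo.double_right h.1 h', fun hd => h.2 ?_⟩
    have := isDyadic_half_iff.2 (hd.sub (isDyadic_intCast (-1)))
    convert this using 1
    push_cast
    ring
  one_sub_right {t} h := by
    refine ⟨parameterInvariant_Ioo.one_sub_right h.1, fun hd => h.2 ?_⟩
    simpa using isDyadic_one.sub hd

lemma IsState.not_isSingular {p : PhasePoint} (hp : IsState nonPower nonDyadic p) :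
    ¬ IsSingular p := by
  rintro ⟨i, hi⟩
  induction i generalizing p with
  | zero => exact (hp.step parameterInvariant_nonPower).1.2.1 hi.2
  | succ i ih =>
    rcases (hp.step parameterInvariant_nonPower).2 with h | ⟨-, h | h⟩
    · exact ih h hi.2
    · exact h.2 0 (by norm_num)
    · exact h.2 isDyadic_half

lemma IsState.mem_phaseSpace {p : PhasePoint} (hp : IsState nonPower nonDyadic p) :
    p ∈ necktie.phaseSpace :=
  mem_phaseSpace_iff.2 ⟨(hp.step parameterInvariant_nonPower).1, hp.not_isSingular,
    (hp.swap parameterInvariant_nonPower).not_isSingular⟩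

lemma topRight_mem_phaseSpace {u t : ℝ} (hu : 1 < u) (hu' : u < 2) (ht : t ∈ nonDyadic) :
    topRight u t ∈ necktie.phaseSpace := by
  have hu'' : u ∈ nonPower := by
    refine ⟨⟨by linarith, hu'⟩, fun k hk => ?_⟩
    have : (1 : ℝ) ≤ 2 ^ k := one_le_pow₀ one_le_two
    nlinarith
  simpa using (IsState.topRight (false, false) hu'' hu ht).mem_phaseSpace

/-- Every leading digit 1 is removed in two steps, `u` being halved, until `t = 1 / 2` is left and
the chord ends in a corner. -/
lemma IsBreak.isSingular {u t : ℝ} (h : IsBreak t) (hu : 0 < u) (hu' : u < 2) :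
    IsSingular (rightLower u t) := by
  induction h generalizing u with
  | half =>
    refine (step_rightLower_of_le_half hu hu' (by norm_num) le_rfl).isSingular_of_secondIsVertex ?_
    rw [add_halves]
    exact secondIsVertex_lowerLeft_one u
  | @succ t h ih =>
    obtain ⟨h0, h1⟩ := h.mem_Ioo
    refine .of_step (step_rightLower_of_half_lt hu hu' (by linarith) (by linarith)) ?_
    rw [mul_div_cancel₀ _ two_ne_zero, add_sub_cancel_left]
    exact .of_step (step_lowerBottom hu hu' h0 h1) (sym_isSingular.2 (ih (by linarith)
      (by linarith)))

/-! ### The return map -/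

/-- The first point is a point of the kite on one of the two edges that meet at `w₀`. -/
def IsAtTop (p : PhasePoint) : Prop := p.sign = true ∧ (p.x.2 = 2 ∨ p.x.1 = 5)

lemma sym_isAtTop {g : Bool × Bool} {p : PhasePoint} : IsAtTop (sym g p) ↔ IsAtTop p := by
  obtain ⟨s, x, y⟩ := p
  obtain ⟨_ | _, _ | _⟩ := g <;> cases s <;> simp [IsAtTop, sym, tableSym] <;> grind

/-- The point `q` is reached from `p` after `n` steps, none of which starts at the top. -/
def IsPath (n : ℕ) (p q : PhasePoint) : Prop :=
  necktie.billiardMap^[n] p = q ∧ ∀ m < n, ¬ IsAtTop (necktie.billiardMap^[m] p)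

lemma Step.isPath {p q : PhasePoint} (h : Step p q) (hp : ¬ IsAtTop p) : IsPath 1 p q :=
  ⟨h.2, fun m hm => by obtain rfl : m = 0 := by omega
                       exact hp⟩

lemma IsPath.trans {m n : ℕ} {p q r : PhasePoint} (h : IsPath m p q) (h' : IsPath n q r) :
    IsPath (m + n) p r := by
  refine ⟨by rw [add_comm, Function.iterate_add_apply, h.1, h'.1], fun k hk => ?_⟩
  rcases lt_or_ge k m with hkm | hkm
  · exact h.2 k hkm
  · obtain ⟨j, rfl⟩ := Nat.exists_eq_add_of_le hkm
    rw [add_comm, Function.iterate_add_apply, h.1]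
    exact h'.2 j (by omega)

lemma IsPath.sym {n : ℕ} {p q : PhasePoint} (g : Bool × Bool) (h : IsPath n p q) :
    IsPath n (sym g p) (sym g q) :=
  ⟨by rw [iterate_billiardMap_sym, h.1], fun m hm => by
    rw [iterate_billiardMap_sym, sym_isAtTop]
    exact h.2 m hm⟩

lemma not_isAtTop_lower {u : ℝ} (hu : u < 2) (y : Plane) : ¬ IsAtTop ⟨true, (3 + u, u / 2), y⟩ := by
  simp only [IsAtTop, true_and]
  rintro (h | h) <;> linarith

lemma not_isAtTop_false (x y : Plane) : ¬ IsAtTop ⟨false, x, y⟩ := by simp [IsAtTop]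

/-- Each carry encloses the path for `u / 2` between two steps that remove a digit 1 and two that
insert a digit 0 and restore `u`. As `u / 2 < 1`, the orbit cannot reach the top edges in between.
-/
lemma AddOne.isPath {l : ℕ} {t t' u : ℝ} (h : AddOne l t t') (hu : 0 < u) (hu' : u < 2) :
    IsPath (4 * l + 1) (rightLower u t) (lowerLeft u t') := by
  induction h generalizing u with
  | zero h h' =>
    exact (step_rightLower_of_le_half hu hu' h h'.le).isPath (not_isAtTop_false _ _)
  | @succ l t t' h ih =>
    obtain ⟨⟨h0, h1⟩, h0', h1'⟩ := h.mem_Ioo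
    have s1 := step_rightLower_of_half_lt (t := (1 + t) / 2) hu hu' (by linarith) (by linarith)
    rw [mul_div_cancel₀ _ two_ne_zero, add_sub_cancel_left] at s1
    have s2 := step_lowerBottom hu hu' h0 h1
    have s3 := (ih (half_pos hu) (by linarith)).sym (true, true)
    have s4 := (step_lowerLeft_of_lt_one (half_pos hu) (by linarith) h0' h1').sym (true, true)
    rw [mul_div_cancel₀ _ two_ne_zero, sym_sym] at s4
    have s5 := (step_bottomLower hu hu' h0' h1').sym (true, false)
    rw [sym_sym_self] at s5
    have path := (((s1.isPath (not_isAtTop_false _ _)).trans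
      (s2.isPath (not_isAtTop_lower hu' _))).trans s3).trans
      ((s4.isPath (by rw [sym_isAtTop]; exact not_isAtTop_lower (by linarith) _)).trans
      (s5.isPath (not_isAtTop_false _ _)))
    convert path using 1
    ring

/-- One step leads into `rightLower`, and two lead out of `lowerLeft` over `leftTop`; with the `4 *
l + 1` steps between, these make `4 * (l + 1)`. -/
lemma AddOne.iterate_topRight {l : ℕ} {t t' u : ℝ} (h : AddOne l t t') (hu : 1 < u)
    (hu' : u < 2) :
    necktie.billiardMap^[4 * (l + 1)] (topRight u t) = topRight u t' ∧
      ∀ m, 0 < m → m < 4 * (l + 1) → ¬ IsAtTop (necktie.billiardMap^[m] (topRight u t)) := by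
  obtain ⟨⟨h0, h1⟩, h0', h1'⟩ := h.mem_Ioo
  have path : IsPath (4 * l + 1 + (1 + 1)) (rightLower u t) (topRight u t') :=
    (h.isPath (by linarith) hu').trans
    (((step_lowerLeft_of_one_le hu.le hu' h0' h1').isPath (not_isAtTop_lower hu' _)).trans
      ((step_leftTop hu hu' h0' h1').isPath (not_isAtTop_false _ _)))
  have step := (step_topRight hu hu' h0 h1).2
  constructor
  · rw [← path.1, ← step, ← Function.iterate_succ_apply]
    rfl
  · intro m hm hm'
    obtain ⟨m, rfl⟩ := Nat.exists_eq_succ_of_ne_zero hm.ne'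
    rw [Function.iterate_succ_apply, step]
    exact path.2 m (by omega)

lemma HitsBreak.isSingular {u t : ℝ} (h : HitsBreak t) (hu : 1 < u) (hu' : u < 2) :
    IsSingular (topRight u t) := by
  induction h with
  | isBreak h =>
    exact .of_step (step_topRight hu hu' h.mem_Ioo.1 h.mem_Ioo.2)
      (h.isSingular (by linarith) hu')
  | addOne h _ ih =>
    rw [← (h.iterate_topRight hu hu').1] at ih
    exact isSingular_of_iterate ih

lemma topRight_mem_phaseSpace_iff {u t : ℝ} (hu : 1 < u) (hu' : u < 2)
    (ht : t ∈ Set.Ioo (0 : ℝ) 1) :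
    topRight u t ∈ necktie.phaseSpace ↔ ¬ IsDyadic t :=
  ⟨fun h hd => (mem_phaseSpace_iff.1 h).2.1 ((hd.hitsBreak ht).isSingular hu hu'),
    fun h => topRight_mem_phaseSpace hu hu' ⟨ht, h⟩⟩

lemma isAtTop_topRight (u t : ℝ) : IsAtTop (topRight u t) := ⟨rfl, .inl rfl⟩

lemma iterate_topRight_ne {u t : ℝ} (hu : 1 < u) (hu' : u < 2) (ht : t ∈ nonDyadic) {n : ℕ}
    (hn : 0 < n) : necktie.billiardMap^[n] (topRight u t) ≠ topRight u t := by
  -- The target `s` is kept apart from `t`, since the induction moves the starting point along the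
  -- return map.
  suffices ∀ n s t, t ∈ nonDyadic → 0 < n →
      necktie.billiardMap^[n] (topRight u t) = topRight u s →
      ∃ m, 0 < m ∧ vonNeumannKakutani^[m] t = s by
    intro h
    obtain ⟨m, hm, h'⟩ := this n t t ht hn h
    exact vonNeumannKakutani_iterate_ne ht hm h'
  intro n
  induction n using Nat.strong_induction_on with
  | _ n ih =>
    intro s t ht hn h
    obtain ⟨l, t', hl⟩ := exists_addOne ht
    obtain ⟨h1, h2⟩ := hl.iterate_topRight hu hu'
    -- An earlier arrival at `topRight u s` would be a visit to the top before the return.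
    have hle : 4 * (l + 1) ≤ n := by
      by_contra! hlt
      exact h2 n hn hlt (h ▸ isAtTop_topRight u s)
    obtain ⟨k, rfl⟩ := Nat.exists_eq_add_of_le' hle
    rw [Function.iterate_add_apply, h1] at h
    rcases Nat.eq_zero_or_pos k with rfl | hk
    · refine ⟨1, one_pos, ?_⟩
      have : (2 : ℝ) - 2 * t' = 2 - 2 * s := congrArg (fun p : PhasePoint => p.y.2) h
      rw [Function.iterate_one, hl.vonNeumannKakutani_eq]
      linarith
    · obtain ⟨m, -, hm⟩ := ih k (by omega) s t' (hl.mem_nonDyadic ht) hk h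
      refine ⟨m + 1, m.succ_pos, ?_⟩
      rw [Function.iterate_succ_apply, hl.vonNeumannKakutani_eq, hm]

/-! ### Every orbit visits a slice -/

/-- The orbit of `p` visits the images of the points `topRight u t`. -/
def VisitsTop (p : PhasePoint) : Prop :=
  ∃ (k : ℕ) (g : Bool × Bool) (u t : ℝ), 1 < u ∧ u < 2 ∧ t ∈ Set.Ioo (0 : ℝ) 1 ∧
    necktie.billiardMap^[k] p = sym g (topRight u t)

lemma sym_visitsTop {g : Bool × Bool} {p : PhasePoint} : VisitsTop (sym g p) ↔ VisitsTop p := by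
  have key : ∀ p, VisitsTop p → VisitsTop (sym g p) := by
    rintro p ⟨k, h, u, t, hu, hu', ht, e⟩
    exact ⟨k, _, u, t, hu, hu', ht, by rw [iterate_billiardMap_sym, e, sym_sym]⟩
  exact ⟨fun h => by simpa using key _ h, key p⟩

lemma visitsTop_topRight {u t : ℝ} (hu : 1 < u) (hu' : u < 2) (ht : t ∈ Set.Ioo (0 : ℝ) 1) :
    VisitsTop (topRight u t) := ⟨0, (false, false), u, t, hu, hu', ht, by simp⟩

lemma Step.visitsTop {p q : PhasePoint} (h : Step p q) (hp : p ∈ necktie.phaseSpace)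
    (hq : q ∈ necktie.phaseSpace → VisitsTop q) : VisitsTop p := by
  obtain ⟨k, g, u, t, hu, hu', ht, e⟩ := hq (h.2 ▸ mapsTo_phaseSpace hp)
  exact ⟨k + 1, g, u, t, hu, hu', ht, by rw [Function.iterate_succ_apply, h.2, e]⟩

lemma visitsTop_leftTop {u t : ℝ} (hu : 1 < u) (hu' : u < 2) (ht : t ∈ Set.Ioo (0 : ℝ) 1)
    (hp : leftTop u t ∈ necktie.phaseSpace) : VisitsTop (leftTop u t) :=
  (step_leftTop hu hu' ht.1 ht.2).visitsTop hp fun _ => visitsTop_topRight hu hu' ht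

lemma visitsTop_lowerLeft {u t : ℝ} (hu : u ∈ Set.Ioo (0 : ℝ) 2) (ht : t ∈ Set.Ioo (0 : ℝ) 1)
    (hp : lowerLeft u t ∈ necktie.phaseSpace) : VisitsTop (lowerLeft u t) := by
  -- The exponent bounds the number of doublings before `u` exceeds 1.
  obtain ⟨n, hn⟩ := exists_pow_lt_of_lt_one hu.1 (one_half_lt_one (α := ℝ))
  induction n generalizing u t with
  | zero =>
    rw [pow_zero] at hn
    exact (step_lowerLeft_of_one_le hn.le hu.2 ht.1 ht.2).visitsTop hp
      (visitsTop_leftTop hn hu.2 ht)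
  | succ n ih =>
    rcases lt_trichotomy u 1 with h | rfl | h
    · refine (step_lowerLeft_of_lt_one hu.1 h ht.1 ht.2).visitsTop hp fun hq => ?_
      rw [sym_mem_phaseSpace] at hq
      rw [sym_visitsTop]
      refine (step_bottomLower (by linarith [hu.1]) (by linarith) ht.1 ht.2).visitsTop hq
        fun hr => ?_
      rw [sym_mem_phaseSpace] at hr
      rw [sym_visitsTop]
      rw [pow_succ] at hn
      exact ih (parameterInvariant_Ioo.double_left hu h) (parameterInvariant_Ioo.half_right ht) hr
        (by linarith)
    · exact absurd ((step_lowerLeft_of_one_le le_rfl hu.2 ht.1 ht.2).isSingular_of_secondIsVertex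
        (secondIsVertex_leftTop_one t)) (mem_phaseSpace_iff.1 hp).2.1
    · exact (step_lowerLeft_of_one_le h.le hu.2 ht.1 ht.2).visitsTop hp
        (visitsTop_leftTop h hu.2 ht)

lemma visitsTop_rightLower {u t : ℝ} (hu : u ∈ Set.Ioo (0 : ℝ) 2) (ht : t ∈ Set.Ioo (0 : ℝ) 1)
    (hp : rightLower u t ∈ necktie.phaseSpace) : VisitsTop (rightLower u t) := by
  -- Removing a digit 1 doubles `1 - t`, so the exponent bounds the number of leading digits 1.
  obtain ⟨n, hn⟩ := exists_pow_lt_of_lt_one (sub_pos.2 ht.2) (one_half_lt_one (α := ℝ))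
  induction n generalizing u t with
  | zero =>
    rw [pow_zero] at hn
    linarith [ht.1]
  | succ n ih =>
    rcases lt_trichotomy t (1 / 2) with h | rfl | h
    · exact (step_rightLower_of_le_half hu.1 hu.2 ht.1 h.le).visitsTop hp
        (visitsTop_lowerLeft hu (parameterInvariant_Ioo.add_half_right ht h))
    · exact absurd (IsBreak.half.isSingular hu.1 hu.2) (mem_phaseSpace_iff.1 hp).2.1
    · have ht' := parameterInvariant_Ioo.double_right ht h
      refine (step_rightLower_of_half_lt hu.1 hu.2 h ht.2).visitsTop hp fun hq => ?_
      refine (step_lowerBottom hu.1 hu.2 ht'.1 ht'.2).visitsTop hq fun hr => ?_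
      rw [sym_mem_phaseSpace] at hr
      rw [sym_visitsTop]
      rw [pow_succ] at hn
      exact ih (parameterInvariant_Ioo.half_left hu) ht' hr (by linarith)

lemma visitsTop_of_mem_phaseSpace {p : PhasePoint} (hp : p ∈ necktie.phaseSpace) :
    VisitsTop p := by
  have h := isRegular_of_mem_phaseSpace hp
  cases h with
  | topRight g hu hu' ht => exact sym_visitsTop.2 (visitsTop_topRight hu' hu.2 ht)
  | leftTop g hu hu' ht =>
    exact sym_visitsTop.2 (visitsTop_leftTop hu' hu.2 ht (sym_mem_phaseSpace.1 hp))
  | rightLower g hu ht =>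
    exact sym_visitsTop.2 (visitsTop_rightLower hu ht (sym_mem_phaseSpace.1 hp))
  | lowerLeft g hu ht =>
    exact sym_visitsTop.2 (visitsTop_lowerLeft hu ht (sym_mem_phaseSpace.1 hp))
  | lowerBottom g hu ht =>
    refine sym_visitsTop.2 ((step_lowerBottom hu.1 hu.2 ht.1 ht.2).visitsTop
      (sym_mem_phaseSpace.1 hp) fun hq => ?_)
    exact sym_visitsTop.2 (visitsTop_rightLower (parameterInvariant_Ioo.half_left hu) ht
      (sym_mem_phaseSpace.1 hq))
  | bottomLower g hu ht =>
    refine sym_visitsTop.2 ((step_bottomLower hu.1 hu.2 ht.1 ht.2).visitsTop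
      (sym_mem_phaseSpace.1 hp) fun hq => ?_)
    exact sym_visitsTop.2 (visitsTop_lowerLeft hu (parameterInvariant_Ioo.half_right ht)
      (sym_mem_phaseSpace.1 hq))

/-- A period is inherited by the visit to the top, where `iterate_topRight_ne` forbids it. -/
lemma notMem_periodicPts_billiardMap {p : PhasePoint} (hp : p ∈ necktie.phaseSpace) :
    p ∉ Function.periodicPts necktie.billiardMap := by
  rintro ⟨n, hn, h⟩
  obtain ⟨k, g, u, t, hu, hu', ht, e⟩ := visitsTop_of_mem_phaseSpace hp
  have hq := mapsTo_phaseSpace.iterate k hp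
  have h' := h.apply_iterate k
  rw [e] at h' hq
  rw [sym_mem_phaseSpace, topRight_mem_phaseSpace_iff hu hu' ht] at hq
  rw [Function.IsPeriodicPt, Function.IsFixedPt, iterate_billiardMap_sym] at h'
  refine iterate_topRight_ne hu hu' ⟨ht, hq⟩ hn ?_
  simpa using congrArg (sym g) h'

/-! ### The slices -/

/-- The four choices of edge and of oriented side `(a, b)` are the images of the top edge and `(v₀,
v₁)` under the four symmetries, so all slices reduce to `topRight`. -/
lemma IsBase.exists_sym {x a b : Plane} (h : IsBase x a b) :
    ∃ (g : Bool × Bool) (u : ℝ), 1 < u ∧ u < 2 ∧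
      ∀ t, slicePoint x a b t = sym g (topRight u t) := by
  obtain ⟨x1, x2⟩ := x
  rcases h with ⟨hx, h⟩ | ⟨hx, h⟩
  · obtain ⟨r, h0, h1, hx⟩ := mem_plane_openSegment.1 hx
    simp [kite] at hx
    obtain ⟨rfl, rfl⟩ := hx
    rcases h with ⟨rfl, rfl⟩ | ⟨rfl, rfl⟩
    · refine ⟨(false, false), 2 - r, by linarith, by linarith, fun t => ?_⟩
      simp [slicePoint, sym, tableSym, topRight, square]
      grind
    · refine ⟨(true, false), 2 - r, by linarith, by linarith, fun t => ?_⟩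
      simp [slicePoint, sym, tableSym, topRight, square]
      grind
  · obtain ⟨r, h0, h1, hx⟩ := mem_plane_openSegment.1 hx
    simp [kite] at hx
    obtain ⟨rfl, rfl⟩ := hx
    rcases h with ⟨rfl, rfl⟩ | ⟨rfl, rfl⟩
    · refine ⟨(false, true), 1 + r, by linarith, by linarith, fun t => ?_⟩
      simp [slicePoint, sym, tableSym, topRight, square]
      grind
    · refine ⟨(true, true), 1 + r, by linarith, by linarith, fun t => ?_⟩
      simp [slicePoint, sym, tableSym, topRight, square]
      grind

lemma exists_isBase (g : Bool × Bool) {u : ℝ} (hu : 1 < u) (hu' : u < 2) :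
    ∃ x a b, IsBase x a b ∧ ∀ t, slicePoint x a b t = sym g (topRight u t) := by
  have h1 : ((3 + u, 2) : Plane) ∈ openSegment ℝ (kite 0) (kite 1) :=
    mem_plane_openSegment.2 ⟨2 - u, by linarith, by linarith, by simp [kite]; ring, by simp [kite]⟩
  have h2 : ((5, u) : Plane) ∈ openSegment ℝ (kite 3) (kite 0) :=
    mem_plane_openSegment.2 ⟨u - 1, by linarith, by linarith, by simp [kite], by
      simp [kite]; ring⟩
  obtain ⟨_ | _, _ | _⟩ := g
  · refine ⟨_, _, _, .inl ⟨h1, .inl ⟨rfl, rfl⟩⟩, fun t => ?_⟩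
    simp [slicePoint, sym, tableSym, topRight, square]
    grind
  · refine ⟨_, _, _, .inr ⟨h2, .inl ⟨rfl, rfl⟩⟩, fun t => ?_⟩
    simp [slicePoint, sym, tableSym, topRight, square]
    grind
  · refine ⟨_, _, _, .inl ⟨h1, .inr ⟨rfl, rfl⟩⟩, fun t => ?_⟩
    simp [slicePoint, sym, tableSym, topRight, square]
    grind
  · refine ⟨_, _, _, .inr ⟨h2, .inr ⟨rfl, rfl⟩⟩, fun t => ?_⟩
    simp [slicePoint, sym, tableSym, topRight, square]
    grind

lemma IsBase.slicePoint_mem_phaseSpace_iff {x a b : Plane} (h : IsBase x a b) {t : ℝ}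
    (ht : t ∈ Set.Ioo (0 : ℝ) 1) :
    slicePoint x a b t ∈ necktie.phaseSpace ↔ ¬ IsDyadic t := by
  obtain ⟨g, u, hu, hu', e⟩ := h.exists_sym
  rw [e, sym_mem_phaseSpace, topRight_mem_phaseSpace_iff hu hu' ht]

lemma AddOne.isFirstReturn {l : ℕ} {t t' : ℝ} (h : AddOne l t t') (ht : ¬ IsDyadic t)
    {x a b : Plane} (hb : IsBase x a b) :
    IsFirstReturn necktie.billiardMap (slice x a b) (slicePoint x a b t) (4 * (l + 1))
      (slicePoint x a b t') := by
  obtain ⟨g, u, hu, hu', e⟩ := hb.exists_sym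
  obtain ⟨h1, h2⟩ := h.iterate_topRight hu hu'
  refine ⟨by omega, ?_, ?_, ?_⟩
  · rw [e, e, iterate_billiardMap_sym, h1]
  · exact ⟨(hb.slicePoint_mem_phaseSpace_iff h.mem_Ioo.2).2 (h.not_isDyadic ht), t', h.mem_Ioo.2,
      rfl⟩
  -- Any point of the slice is at the top, which `h2` excludes at intermediate times.
  · rintro m hm hm' ⟨-, s, -, hs⟩
    refine h2 m hm hm' ?_
    rw [e, e, iterate_billiardMap_sym] at hs
    rw [← sym_isAtTop (g := g), ← hs, sym_isAtTop]
    exact isAtTop_topRight u s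

end SymplecticBilliards

theorem mainTheorem5 :
    -- the symplectic billiard map is a bijection of the phase space
    Set.BijOn necktie.billiardMap necktie.phaseSpace necktie.phaseSpace ∧
    -- there are no periodic orbits
    (∀ p ∈ necktie.phaseSpace, p ∉ Function.periodicPts necktie.billiardMap) ∧
    -- every orbit visits one of the slices
    (∀ p ∈ necktie.phaseSpace, ∃ (k : ℕ) (x a b : Plane),
      IsBase x a b ∧ necktie.billiardMap^[k] p ∈ slice x a b) ∧
    -- in every slice, exactly the dyadic rationals are missing from the phase space
    (∀ x a b : Plane, IsBase x a b → ∀ t ∈ Set.Ioo (0 : ℝ) 1,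
      (slicePoint x a b t ∈ necktie.phaseSpace ↔ ¬ IsDyadic t)) ∧
    -- the first return map of every slice is the von Neumann–Kakutani transformation
    (∀ x a b : Plane, IsBase x a b → ∀ t ∈ Set.Ioo (0 : ℝ) 1, ¬ IsDyadic t →
      ∃ n : ℕ, IsFirstReturn necktie.billiardMap (slice x a b)
        (slicePoint x a b t) n (slicePoint x a b (vonNeumannKakutani t))) ∧
    -- this transformation is the interval exchange with the following translations,
    -- and the following are the return times
    (∀ l : ℕ, ∀ t ∈ Set.Ioo (1 - (1 / 2 : ℝ) ^ l) (1 - (1 / 2 : ℝ) ^ (l + 1)),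
      vonNeumannKakutani t = t - 1 + (1 / 2 : ℝ) ^ l + (1 / 2 : ℝ) ^ (l + 1) ∧
      (¬ IsDyadic t → ∀ x a b : Plane, IsBase x a b →
        IsFirstReturn necktie.billiardMap (slice x a b)
          (slicePoint x a b t) (4 * (l + 1)) (slicePoint x a b (vonNeumannKakutani t)))) ∧
    -- neither the transformation nor the dyadic odometer has periodic points
    (∀ t ∈ Set.Ioo (0 : ℝ) 1, ¬ IsDyadic t → t ∉ Function.periodicPts vonNeumannKakutani) ∧
    (∀ a : ℕ → Fin 2, a ∉ Function.periodicPts odometer) := by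
  refine ⟨bijOn_phaseSpace, fun p hp => notMem_periodicPts_billiardMap hp, fun p hp => ?_,
    fun x a b hb t ht => hb.slicePoint_mem_phaseSpace_iff ht, fun x a b hb t ht hd => ?_,
    fun l t ht => ?_, fun t ht hd => ?_, notMem_periodicPts_odometer⟩
  · obtain ⟨k, g, u, t, hu, hu', ht, e⟩ := visitsTop_of_mem_phaseSpace hp
    obtain ⟨x, a, b, hb, hs⟩ := exists_isBase g hu hu'
    exact ⟨k, x, a, b, hb, mapsTo_phaseSpace.iterate k hp, t, ht, by rw [hs, e]⟩
  · obtain ⟨l, t', h⟩ := exists_addOne ⟨ht, hd⟩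
    rw [h.vonNeumannKakutani_eq]
    exact ⟨_, h.isFirstReturn hd hb⟩
  · have h := addOne_of_mem ht
    rw [h.vonNeumannKakutani_eq]
    exact ⟨rfl, fun hd x a b hb => h.isFirstReturn hd hb⟩
  · rintro ⟨n, hn, h⟩
    exact vonNeumannKakutani_iterate_ne ⟨ht, hd⟩ hn h
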